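/- Conventions. All coproducts are small (indexed by sets). In a triangulated category $\mathcal{C}$ closed under coproducts, an object $X$ is compact if $\mathcal{C}(X,-)$ (with values in abelian groups) commutes with coproducts, and the localizing subcategory generated by a class $D$ of objects is the smallest strict full triangulated subcategory of $\mathcal{C}$ that contains $D$ and is closed under coproducts. For a class $D$ of objects and $i\in\mathbb{Z}$, $D[i]$ is the class of objects isomorphic to $X[i]$ with $X\in D$; we write $D\perp E$ if $\mathcal{C}(X,Y)=0$ for all $X\in D$, $Y\in E$, and $D^{\perp}=\{Y: \mathcal{C}(X,Y)=0\ \forall X\in D\}$. A class is Karoubi-closed if it contains all retracts of its elements; the Karoubi-closure of a class consists of all retracts of its elements. A weight structure $w$ on a triangulated category $\mathcal{C}$ is a pair of Karoubi-closed classes $\mathcal{C}_{w\le 0},\mathcal{C}_{w\ge 0}$ of objects such that $\mathcal{C}_{w\le 0}\subset\mathcal{C}_{w\le 0}[1]$, $\mathcal{C}_{w\ge 0}[1]\subset\mathcal{C}_{w\ge 0}$, $\mathcal{C}_{w\le 0}\perp\mathcal{C}_{w\ge 0}[1]$, and every object $M$ fits into a distinguished triangle $X\to M\to Y\to X[1]$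 with $X\in\mathcal{C}_{w\le 0}$, $Y\in\mathcal{C}_{w\ge 0}[1]$. Put $\mathcal{C}_{w\le i}=\mathcal{C}_{w\le 0}[i]$ and $\mathcal{C}_{w\ge i}=\mathcal{C}_{w\ge 0}[i]$. An object is $w$-bounded below if it belongs to $\bigcup_{i\in\mathbb{Z}}\mathcal{C}_{w\ge i}$, and right $w$-degenerate if it belongs to $\bigcap_{i\in\mathbb{Z}}\mathcal{C}_{w\le i}$. The weight structure $w$ is generated by a class $H$ if $\mathcal{C}_{w\ge 0}=\bigl(\bigcup_{i>0}H[-i]\bigr)^{\perp}$. Proposition. Let $\mathcal{C}$ be a triangulated category closed under coproducts whose subcategory of compact objects is essentially small and generates $\mathcal{C}$ as its own localizing subcategory. Let $H$ be a full additive subcategory of $\mathcal{C}$ that consists of compact objects, generates $\mathcal{C}$ as its own localizing subcategory, and is negative, i.e. $H\perp H[i]$ for all $i>0$. Let $H_1,H_2,H_3$ be full additive subcategories of $H$, let $\mathcal{C}_j$ be the localizing subcategory of $\mathcal{C}$ generated by $H_j$ ($j=1,2,3$), and let $\pi:\mathcal{C}\to\mathcal{C}'=\mathcal{C}/\mathcal{C}_3$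 be the Verdier localization. Assume that $\pi(f)=0$ for every morphism $f$ of $\mathcal{C}$ from an object of $H_1$ to an object of $H_2$. Then there is a unique weight structure $w$ on $\mathcal{C}$ generated by $H$; the Karoubi-closures in $\mathcal{C}'$ of $\pi(\mathcal{C}_{w\le 0})$ and $\pi(\mathcal{C}_{w\ge 0})$ define a weight structure $w'$ on $\mathcal{C}'$; and for every object $M$ of $\mathcal{C}_1\cap\mathcal{C}_2$: 1. $\pi(M)$ is right $w'$-degenerate in $\mathcal{C}'$; 2. if $M$ is $w$-bounded below, then $M$ belongs to $\mathcal{C}_3$. -/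

import Mathlib

open CategoryTheory Limits Pretriangulated ZeroObject

universe v u

section

variable {C : Type u} [Category.{v} C] [Preadditive C]

/-- `X` is compact if `Hom(X, -) : C ⥤ Ab` commutes with all small coproducts. -/
def compactObjects (C : Type u) [Category.{v} C] [Preadditive C] : ObjectProperty C :=
  fun X => ∀ J : Type v,
    PreservesColimitsOfShape (Discrete J) (preadditiveCoyoneda.obj (Opposite.op X))

/-- The full subcategory with object class `H` is an additive subcategory: up to isomorphism,
it contains the zero object and is closed under finite (bi)products. -/
structure IsAdditiveSubcategory (H : ObjectProperty C) : Prop where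
  containsZero : H.ContainsZero
  closedUnderSums : H.isoClosure.IsClosedUnderBinaryProducts

/-- The (strict) class `P[i]` of all objects isomorphic to `X⟦i⟧` with `X` in `P`. -/
def shiftedClass [HasShift C ℤ] (P : ObjectProperty C) (i : ℤ) : ObjectProperty C :=
  P.map (shiftFunctor C i)

/-- `H` is negative: there are no nonzero morphisms from `H` into `H[i]` for `i > 0`. -/
def IsNegativeSubcategory [HasShift C ℤ] (H : ObjectProperty C) : Prop :=
  ∀ i : ℤ, 0 < i → H ≤ (shiftedClass H i).leftOrthogonal

end

section

variable {C : Type u} [Category.{v} C] [Preadditive C] [HasZeroObject C] [HasShift C ℤ]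
  [∀ n : ℤ, (shiftFunctor C n).Additive] [Pretriangulated C]

/-- `P` is (the object class of) a full strict triangulated subcategory closed under small
coproducts. -/
structure IsLocalizingSubcategory (P : ObjectProperty C) : Prop where
  triangulated : P.IsTriangulated
  isoClosed : P.IsClosedUnderIsomorphisms
  coproducts : ∀ J : Type v, P.IsClosedUnderColimitsOfShape (Discrete J)

/-- The localizing subcategory generated by `D`: the smallest full strict triangulated
subcategory that is closed under small coproducts and contains `D`. -/
def localizingClosure (D : ObjectProperty C) : ObjectProperty C :=
  fun X => ∀ P : ObjectProperty C, IsLocalizingSubcategory P → D ≤ P → P X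

theorem localizingClosure_isLocalizing (D : ObjectProperty C) :
    IsLocalizingSubcategory (localizingClosure D) := by
  have iso : (localizingClosure D).IsClosedUnderIsomorphisms :=
    ⟨fun e hX P hP hD => by
      have := hP.isoClosed
      exact P.prop_of_iso e (hX P hP hD)⟩
  refine ⟨?_, iso, fun J => ⟨?_⟩⟩
  · have z : (localizingClosure D).ContainsZero :=
      ⟨⟨0, isZero_zero C, fun P hP _ => by
        have := hP.triangulated
        have := hP.isoClosed
        exact P.prop_zero⟩⟩
    have s : (localizingClosure D).IsStableUnderShift ℤ :=
      ⟨fun a => ⟨fun X hX P hP hD => by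
        have := hP.triangulated
        exact P.le_shift a X (hX P hP hD)⟩⟩
    have t : (localizingClosure D).IsTriangulatedClosed₂ :=
      ObjectProperty.IsTriangulatedClosed₂.mk' fun T hT h₁ h₃ P hP hD => by
        have := hP.triangulated
        have := hP.isoClosed
        exact P.ext_of_isTriangulatedClosed₂ T hT (h₁ P hP hD) (h₃ P hP hD)
    exact { toContainsZero := z, toIsStableUnderShift := s, toIsTriangulatedClosed₂ := t }
  · rintro X ⟨c⟩ P hP hD
    have := hP.coproducts J
    exact P.prop_of_isColimit c.isColimit fun j => c.prop_diag_obj j P hP hD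

instance (D : ObjectProperty C) : (localizingClosure D).IsTriangulated :=
  (localizingClosure_isLocalizing D).triangulated

/-- `C` is compactly generated by `H`: the category of compact objects is essentially small and
generates `C` as its own localizing subcategory, and `H` consists of compact objects and
generates `C` as its own localizing subcategory as well. -/
structure IsCompactlyGeneratedBy (H : ObjectProperty C) : Prop where
  essentiallySmall : ObjectProperty.EssentiallySmall.{v} (compactObjects C)
  compacts_generate : localizingClosure (compactObjects C) = ⊤
  le_compact : H ≤ compactObjects C
  generates : localizingClosure H = ⊤

variable (C) in
/-- Weight structures, in the homological convention: `le` is the class `C_{w ≤ 0}` and `ge` is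
the class `C_{w ≥ 0}`. -/
structure WeightStructure where
  le : ObjectProperty C
  ge : ObjectProperty C
  le_retracts : le.IsStableUnderRetracts
  ge_retracts : ge.IsStableUnderRetracts
  le_shift : le ≤ shiftedClass le 1
  shift_ge : shiftedClass ge 1 ≤ ge
  orthogonal : le ≤ (shiftedClass ge 1).leftOrthogonal
  exists_decomposition : ∀ M : C, ∃ (X Y : C) (f : X ⟶ M) (g : M ⟶ Y) (h : Y ⟶ X⟦(1 : ℤ)⟧),
    Triangle.mk f g h ∈ distTriang C ∧ le X ∧ shiftedClass ge 1 Y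

/-- `M` is `w`-bounded below: it belongs to `C_{w ≥ i} = C_{w ≥ 0}[i]` for some integer `i`. -/
def WeightStructure.IsBoundedBelow (w : WeightStructure C) (M : C) : Prop :=
  ∃ i : ℤ, shiftedClass w.ge i M

/-- `M` is right `w`-degenerate: it belongs to `C_{w ≤ i} = C_{w ≤ 0}[i]` for every integer `i`. -/
def WeightStructure.IsRightDegenerate (w : WeightStructure C) (M : C) : Prop :=
  ∀ i : ℤ, shiftedClass w.le i M

/-- `w` is generated by `H`: the class `C_{w ≥ 0}` is the right orthogonal of the union of the
classes `H[-i]` for `i > 0`. -/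
def WeightStructure.IsGeneratedBy (w : WeightStructure C) (H : ObjectProperty C) : Prop :=
  w.ge = ObjectProperty.rightOrthogonal fun X => ∃ i : ℤ, 0 < i ∧ shiftedClass H (-i) X

variable [IsTriangulated C]

/-- The Verdier quotient of `C` by the triangulated subcategory `P`: the localization of `C` with
respect to the morphisms whose cone belongs to `P`, with its induced triangulated structure. -/
abbrev VerdierQuotient (P : ObjectProperty C) [P.IsTriangulated] := P.trW.Localization

/-- The localization functor `π : C ⥤ C / P`. -/
abbrev verdierFunctor (P : ObjectProperty C) [P.IsTriangulated] : C ⥤ VerdierQuotient P :=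
  P.trW.Q

/-- `w'` is the weight structure induced by `w` on the Verdier quotient `C / P`: its two halves
are the Karoubi-closures (closures under retracts) in `C / P` of the images of those of `w`. -/
structure IsInducedOnQuotient (w : WeightStructure C) (P : ObjectProperty C) [P.IsTriangulated]
    (w' : WeightStructure (VerdierQuotient P)) : Prop where
  le_eq : w'.le = (w.le.map (verdierFunctor P)).retractClosure
  ge_eq : w'.ge = (w.ge.map (verdierFunctor P)).retractClosure

end

/-! Weights are taken relative to `H`, and C_j is the localizing subcategory generated by `H_j`.
Since `H` is negative and compact, every object of C_j has weight decompositions with both parts in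
C_j that are also decompositions in C (`exists_weight_decomposition`). Decomposing fibres in C_3
shows that morphisms π(A) → π(Y) lift to C when A has weight ≤ n and Y has weight ≥ n
(`verdierFunctor_map_surjective_of_weight`); hence the orthogonality of w'.

The hypothesis on `H₁` and `H₂` sharpens orthogonality by one weight: π(A) → π(B) vanishes already
for A in C_1 of weight ≤ n and B in C_2 of weight ≥ n (`homVanishes_verdierFunctor_of_vanish`).
Indeed, a lift passes through objects of weight exactly n in C_1 and C_2, and these are retracts of
coproducts of objects of `H_j[n]`. For M in both subcategories, truncating alternately in C_2 and
C_1 then pushes a map π(A) → π(M) down one weight at a time, so it factors through truncations of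
arbitrarily low weight (`exists_factorization_through_truncation`).

Finally M is the homotopy colimit of its truncations in C_1 (`exists_telescope_triangle`). In the
quotient both the maps to M and the transition maps factor through low weight, so no nonzero
morphism leads from π(M) to weight ≥ 1. Applied to all shifts of M, this is right degeneracy. If M
is bounded below, some shift of M itself has weight ≥ 1, so π(M) = 0, and M lies in C_3 because
localizing subcategories are closed under retracts. -/

/-- Every morphism from `X` to `Y` is zero. -/
def HomVanishes {C : Type*} [Category* C] [HasZeroMorphisms C] (X Y : C) : Prop :=
  ∀ f : X ⟶ Y, f = 0

namespace HomVanishes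

section

variable {C : Type*} [Category* C] [HasZeroMorphisms C]

lemma of_iso {X X' Y Y' : C} (h : HomVanishes X Y) (e : X ≅ X') (e' : Y ≅ Y') :
    HomVanishes X' Y' := fun f => by
  have := h (e.hom ≫ f ≫ e'.inv)
  rw [← cancel_epi e.hom, ← cancel_mono e'.inv, Category.assoc, this]
  simp

lemma of_retract_left {X X' Y : C} (r : Retract X X') (h : HomVanishes X' Y) :
    HomVanishes X Y := fun f => by
  rw [← Category.id_comp f, ← r.retract, Category.assoc, h (r.r ≫ f), comp_zero]

lemma of_retract_right {X Y Y' : C} (r : Retract Y Y') (h : HomVanishes X Y') :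
    HomVanishes X Y := fun f => by
  rw [← Category.comp_id f, ← r.retract, ← Category.assoc, h (f ≫ r.i), zero_comp]

lemma of_cofan {J : Type*} {A : J → C} {c : Cofan A} (hc : IsColimit c) {Y : C}
    (h : ∀ j, HomVanishes (A j) Y) : HomVanishes c.pt Y := fun f =>
  Cofan.IsColimit.hom_ext hc _ _ fun j => by rw [h j (c.inj j ≫ f), comp_zero]

lemma of_isZero_left {X Y : C} (h : IsZero X) : HomVanishes X Y := fun _ => h.eq_of_src _ _

lemma of_isZero_right {X Y : C} (h : IsZero Y) : HomVanishes X Y := fun _ => h.eq_of_tgt _ _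

end

section

variable {C : Type*} [Category* C] [Preadditive C] [HasShift C ℤ]
  [∀ n : ℤ, (shiftFunctor C n).Additive]

lemma of_shift {X Y : C} (a : ℤ) (h : HomVanishes (X⟦a⟧) (Y⟦a⟧)) : HomVanishes X Y := fun f =>
  (shiftFunctor C a).map_injective (by rw [h (f⟦a⟧'), Functor.map_zero])

lemma shift {X Y : C} (h : HomVanishes X Y) (a : ℤ) : HomVanishes (X⟦a⟧) (Y⟦a⟧) :=
  of_shift (-a) (h.of_iso ((shiftFunctorCompIsoId C a (-a) (by simp)).app X).symm
    ((shiftFunctorCompIsoId C a (-a) (by simp)).app Y).symm)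

lemma shift_add {X Y : C} {i j : ℤ} (h : HomVanishes (X⟦i⟧) Y) (a : ℤ) (hj : i + a = j) :
    HomVanishes (X⟦j⟧) (Y⟦a⟧) :=
  (h.shift a).of_iso ((shiftFunctorAdd' C i a j hj).app X).symm (Iso.refl _)

lemma shift_left {X Y : C} {a b : ℤ} (h : HomVanishes X (Y⟦b⟧)) (hab : a + b = 0) :
    HomVanishes (X⟦a⟧) Y :=
  (h.shift a).of_iso (Iso.refl _) ((shiftFunctorCompIsoId C b a (by omega)).app Y)

variable [HasZeroObject C] [Pretriangulated C]

lemma ext_right {X : C} (T : Triangle C) (hT : T ∈ distTriang C) (h₁ : HomVanishes X T.obj₁)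
    (h₃ : HomVanishes X T.obj₃) : HomVanishes X T.obj₂ := fun f => by
  obtain ⟨g, rfl⟩ := T.coyoneda_exact₂ hT f (h₃ _)
  rw [h₁ g, zero_comp]

lemma ext_left {Y : C} (T : Triangle C) (hT : T ∈ distTriang C) (h₁ : HomVanishes T.obj₁ Y)
    (h₃ : HomVanishes T.obj₃ Y) : HomVanishes T.obj₂ Y := fun f => by
  obtain ⟨g, rfl⟩ := T.yoneda_exact₂ hT f (h₁ _)
  rw [h₃ g, comp_zero]

end

end HomVanishes

/-! ### Morphisms from shifts of compact objects into coproducts. -/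

section

variable {C : Type u} [Category.{v} C] [Preadditive C]

/-- The morphisms into the point of a cofan that are finite sums of morphisms factoring through
the components. -/
def finitelySupportedHoms {J : Type v} {A : J → C} (c : Cofan A) (X : C) : AddSubgroup (X ⟶ c.pt) :=
  AddSubgroup.closure {f | ∃ (j : J) (a : X ⟶ A j), f = a ≫ c.inj j}

/-- The quotient map by the finitely supported morphisms vanishes on every component, hence on the
colimit that compactness provides. -/
lemma mem_finitelySupportedHoms {X : C} (hX : compactObjects C X) {J : Type v} {A : J → C}
    {c : Cofan A} (hc : IsColimit c) (f : X ⟶ c.pt) : f ∈ finitelySupportedHoms c X := by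
  have := hX J
  have hc' := isColimitOfPreserves (preadditiveCoyoneda.obj (Opposite.op X)) hc
  let q : (preadditiveCoyoneda.obj (Opposite.op X)).obj c.pt ⟶
    AddCommGrpCat.of ((X ⟶ c.pt) ⧸ finitelySupportedHoms c X) :=
      AddCommGrpCat.ofHom (QuotientAddGroup.mk' (finitelySupportedHoms c X))
  have hq : q = 0 := hc'.hom_ext fun ⟨j⟩ => by
    ext a
    exact (QuotientAddGroup.eq_zero_iff _).2 (AddSubgroup.subset_closure ⟨j, a, rfl⟩)
  exact (QuotientAddGroup.eq_zero_iff f).1 (congr($hq f))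

/-- Induction principle for morphisms from a shift of a compact object into a coproduct. -/
lemma hom_induction_of_compact [HasShift C ℤ] [∀ n : ℤ, (shiftFunctor C n).Additive]
    {X : C} (hX : compactObjects C X) (i : ℤ) {J : Type v} {A : J → C}
    {c : Cofan A} (hc : IsColimit c) {p : (X⟦i⟧ ⟶ c.pt) → Prop}
    (single : ∀ (j : J) (a : X⟦i⟧ ⟶ A j), p (a ≫ c.inj j))
    (zero : p 0) (add : ∀ f g, p f → p g → p (f + g)) (f : X⟦i⟧ ⟶ c.pt) : p f := by
  have of_mem : ∀ f, f ∈ finitelySupportedHoms c (X⟦i⟧) → p f := fun f hf => by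
    -- `p` is not assumed stable under negation; carrying `p (-f)` along works because the
    -- generators are stable under it.
    have : ∀ f ∈ finitelySupportedHoms c (X⟦i⟧), p f ∧ p (-f) := fun f hf => by
      refine AddSubgroup.closure_induction ?_ ?_ ?_ ?_ hf
      · rintro _ ⟨j, a, rfl⟩
        exact ⟨single j a, by simpa using single j (-a)⟩
      · simpa using zero
      · rintro x y - - ⟨hx, hx'⟩ ⟨hy, hy'⟩
        exact ⟨add _ _ hx hy, by rw [neg_add]; exact add _ _ hx' hy'⟩
      · rintro x - ⟨hx, hx'⟩
        exact ⟨hx', by simpa using hx⟩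
    exact (this f hf).1
  refine of_mem f ?_
  let F := shiftFunctor C (-i)
  let e := (shiftFunctorCompIsoId C i (-i) (by simp)).app X
  let d : Cofan (fun j => F.obj (A j)) := Cofan.mk (F.obj c.pt) fun j => F.map (c.inj j)
  have hd : IsColimit d := isColimitCofanMkObjOfIsColimit F _ _ hc
  have key : ∀ g : X ⟶ F.obj c.pt, g ∈ finitelySupportedHoms d X →
      ∃ f' ∈ finitelySupportedHoms c (X⟦i⟧), e.inv ≫ F.map f' = g := fun g hg => by
    refine AddSubgroup.closure_induction ?_ ?_ ?_ ?_ hg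
    · rintro _ ⟨j, a, rfl⟩
      obtain ⟨b, hb⟩ := F.map_surjective (e.hom ≫ a)
      refine ⟨b ≫ c.inj j, AddSubgroup.subset_closure ⟨j, b, rfl⟩, ?_⟩
      simp [hb, d]
    · exact ⟨0, zero_mem _, by simp⟩
    · rintro x y - - ⟨x', hx, rfl⟩ ⟨y', hy, rfl⟩
      exact ⟨_, add_mem hx hy, by simp [F]⟩
    · rintro x - ⟨x', hx, rfl⟩
      exact ⟨_, neg_mem hx, by simp [F]⟩
  obtain ⟨f', hf', h⟩ := key _ (mem_finitelySupportedHoms hX hd (e.inv ≫ F.map f))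
  rw [cancel_epi] at h
  rwa [← F.map_injective h]

end

section

variable {C : Type u} [Category.{v} C] [Preadditive C] [HasShift C ℤ]
  [∀ n : ℤ, (shiftFunctor C n).Additive] [HasCoproducts.{v} C]

/-- A morphism from a shift of a compact object into a coproduct is determined by its components. -/
lemma hom_ext_of_compact {X : C} (hX : compactObjects C X) {i : ℤ} {J : Type v} [DecidableEq J]
    {A : J → C} {f g : X⟦i⟧ ⟶ ∐ A} (h : ∀ j, f ≫ Sigma.π A j = g ≫ Sigma.π A j) : f = g := by
  have key : ∀ f : X⟦i⟧ ⟶ ∐ A, ∃ s : Finset J, ∀ t, s ⊆ t →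
      f = ∑ j ∈ t, (f ≫ Sigma.π A j) ≫ Sigma.ι A j := by
    refine hom_induction_of_compact hX i (coproductIsCoproduct A) ?_ ?_ ?_
    · intro j a
      refine ⟨{j}, fun t ht => ?_⟩
      rw [Finset.sum_eq_single_of_mem j (ht (by simp))]
      · simp
      · intro k _ hk
        simp [Sigma.ι_π_of_ne A hk.symm]
    · exact ⟨∅, fun t _ => by simp⟩
    · rintro f g ⟨s, hs⟩ ⟨s', hs'⟩
      refine ⟨s ∪ s', fun t ht => ?_⟩
      simp only [Preadditive.add_comp, Finset.sum_add_distrib]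
      rw [← hs t (Finset.union_subset_left ht), ← hs' t (Finset.union_subset_right ht)]
  obtain ⟨s, hs⟩ := key (f - g)
  rw [← sub_eq_zero, hs s subset_rfl]
  exact Finset.sum_eq_zero fun j _ => by
    rw [Preadditive.sub_comp, h j, sub_self, zero_comp]

lemma HomVanishes.coproduct_right {X : C} (hX : compactObjects C X) {i : ℤ} {J : Type v}
    {A : J → C} (h : ∀ j, HomVanishes (X⟦i⟧) (A j)) : HomVanishes (X⟦i⟧) (∐ A) := fun f => by
  classical
  exact hom_ext_of_compact hX fun j => by rw [h j (f ≫ Sigma.π A j), zero_comp]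

end

/-! ### Objects of weight ≥ n and ≤ n. -/

section

variable {C : Type u} [Category.{v} C] [Preadditive C] [HasShift C ℤ]

/-- The objects `Y` such that all morphisms `X⟦i⟧ ⟶ Y` with `X` in `D` and `i < n` vanish. -/
def weightGE (D : ObjectProperty C) (n : ℤ) : ObjectProperty C :=
  fun Y => ∀ X, D X → ∀ i : ℤ, i < n → HomVanishes (X⟦i⟧) Y

/-- The objects admitting only zero morphisms to objects of `weightGE D (n + 1)`. -/
def weightLE (D : ObjectProperty C) (n : ℤ) : ObjectProperty C :=
  fun X => ∀ Y, weightGE D (n + 1) Y → HomVanishes X Y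

variable {D E : ObjectProperty C} {m n : ℤ}

lemma weightGE_antitone (h : m ≤ n) : weightGE D n ≤ weightGE D m :=
  fun _ hY X hX i hi => hY X hX i (by omega)

lemma weightGE_le_of_le (h : D ≤ E) (n : ℤ) : weightGE E n ≤ weightGE D n :=
  fun _ hY X hX i hi => hY X (h X hX) i hi

lemma weightLE_monotone (h : m ≤ n) : weightLE D m ≤ weightLE D n :=
  fun _ hX Y hY => hX Y (weightGE_antitone (by omega) _ hY)

lemma weightLE_le_of_le (h : D ≤ E) (n : ℤ) : weightLE D n ≤ weightLE E n :=
  fun _ hX Y hY => hX Y (weightGE_le_of_le h _ _ hY)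

instance : (weightGE D n).IsStableUnderRetracts :=
  ⟨fun r hY X hX i hi => (hY X hX i hi).of_retract_right r⟩

instance : (weightLE D n).IsStableUnderRetracts :=
  ⟨fun r hX Y hY => (hX Y hY).of_retract_left r⟩

lemma weightLE_shift_of_mem {X : C} (hX : D X) {i : ℤ} (h : i ≤ n) : weightLE D n (X⟦i⟧) :=
  fun _ hY => hY X hX i (by omega)

lemma weightGE_of_isZero {X : C} (hX : IsZero X) : weightGE D n X :=
  fun _ _ _ _ => .of_isZero_right hX

lemma weightLE_of_isZero {X : C} (hX : IsZero X) : weightLE D n X :=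
  fun _ _ => .of_isZero_left hX

lemma weightLE_coproduct [HasCoproducts.{v} C] {J : Type v} {A : J → C}
    (h : ∀ j, weightLE D n (A j)) : weightLE D n (∐ A) :=
  fun Y hY => .of_cofan (coproductIsCoproduct A) fun j => h j Y hY

variable [∀ n : ℤ, (shiftFunctor C n).Additive]

lemma weightGE_coproduct [HasCoproducts.{v} C] (hD : D ≤ compactObjects C) {J : Type v} {A : J → C}
    (h : ∀ j, weightGE D n (A j)) : weightGE D n (∐ A) :=
  fun X hX i hi => .coproduct_right (hD X hX) fun j => h j X hX i hi

lemma weightGE_shift {Y : C} (hY : weightGE D n Y) {a : ℤ} (h : n + a = m) :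
    weightGE D m (Y⟦a⟧) :=
  fun X hX i _ => (hY X hX (i - a) (by omega)).shift_add a (by omega)

lemma weightLE_shift {X : C} (hX : weightLE D n X) {a : ℤ} (h : n + a = m) :
    weightLE D m (X⟦a⟧) :=
  fun Y hY => (hX (Y⟦-a⟧) (weightGE_shift hY (by omega))).shift_left (by omega)

lemma weightGE_shift_of_mem (hneg : IsNegativeSubcategory D) {X : C} (hX : D X) {i : ℤ}
    (h : n ≤ i) : weightGE D n (X⟦i⟧) := fun Y hY j hj => by
  have : HomVanishes Y (X⟦i - j⟧) := fun f =>
    hneg (i - j) (by omega) Y hY f (ObjectProperty.prop_map_obj D (shiftFunctor C (i - j)) hX)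
  exact (this.shift j).of_iso (Iso.refl _)
    ((shiftFunctorAdd' C (i - j) j i (by omega)).app X).symm

variable [HasZeroObject C] [Pretriangulated C]

instance : (weightGE D n).IsTriangulatedClosed₂ :=
  .mk' fun T hT h₁ h₃ X hX i hi => .ext_right T hT (h₁ X hX i hi) (h₃ X hX i hi)

instance : (weightLE D n).IsTriangulatedClosed₂ :=
  .mk' fun T hT h₁ h₃ Y hY => .ext_left T hT (h₁ Y hY) (h₃ Y hY)

end

/-! ### Localizing subcategories and extension products. -/

section

variable {C : Type u} [Category.{v} C] [Preadditive C] [HasZeroObject C] [HasShift C ℤ]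
  [∀ n : ℤ, (shiftFunctor C n).Additive] [Pretriangulated C]

lemma le_localizingClosure (D : ObjectProperty C) : D ≤ localizingClosure D :=
  fun _ hX _ _ h => h _ hX

instance (D : ObjectProperty C) : (localizingClosure D).IsClosedUnderIsomorphisms :=
  (localizingClosure_isLocalizing D).isoClosed

lemma localizingClosure_coproduct [HasCoproducts.{v} C] {D : ObjectProperty C} {J : Type v}
    {A : J → C} (h : ∀ j, localizingClosure D (A j)) : localizingClosure D (∐ A) := by
  have := (localizingClosure_isLocalizing D).coproducts J
  exact ObjectProperty.prop_colimit _ _ fun j => h j.as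

/-- To check that a class closed under isomorphisms and containing zero is localizing, it suffices
to consider shifts, extensions and chosen coproducts. -/
lemma IsLocalizingSubcategory.of_closed [HasCoproducts.{v} C] {P : ObjectProperty C}
    [P.IsClosedUnderIsomorphisms] (hzero : P 0) (hshift : ∀ (X : C) (a : ℤ), P X → P (X⟦a⟧))
    (hext : ∀ T ∈ distTriang C, P T.obj₁ → P T.obj₃ → P T.obj₂)
    (hcoprod : ∀ (J : Type v) (A : J → C), (∀ j, P (A j)) → P (∐ A)) :
    IsLocalizingSubcategory P where
  triangulated :=
    { toContainsZero := ⟨0, isZero_zero C, hzero⟩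
      toIsStableUnderShift := ⟨fun a => ⟨fun X hX => hshift X a hX⟩⟩
      toIsTriangulatedClosed₂ := .mk' hext }
  isoClosed := inferInstance
  coproducts J := ⟨by
    rintro X ⟨c⟩
    refine P.prop_of_iso ?_ (hcoprod J (fun j => c.diag.obj ⟨j⟩) fun j => c.prop_diag_obj ⟨j⟩)
    exact HasColimit.isoOfNatIso Discrete.natIsoFunctor.symm ≪≫
      (colimit.isColimit c.diag).coconePointUniqueUpToIso c.isColimit⟩

/-- An object of the localizing subcategory generated by `D` to which there are no nonzero
morphisms from shifts of objects of `D` is zero. -/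
lemma isZero_of_homVanishes {D : ObjectProperty C} [HasCoproducts.{v} C] {K : C}
    (hK : localizingClosure D K) (h : ∀ X, D X → ∀ i : ℤ, HomVanishes (X⟦i⟧) K) : IsZero K := by
  let P : ObjectProperty C := fun X => ∀ i : ℤ, HomVanishes (X⟦i⟧) K
  have : P.IsClosedUnderIsomorphisms :=
    ⟨fun e hX i => (hX i).of_iso ((shiftFunctor C i).mapIso e) (Iso.refl _)⟩
  have hP : IsLocalizingSubcategory P := .of_closed
    (fun i => .of_isZero_left ((shiftFunctor C i).map_isZero (isZero_zero C)))
    (fun X a hX i =>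
      (hX (a + i)).of_iso ((shiftFunctorAdd' C a i _ rfl).app X) (Iso.refl _))
    (fun T hT h₁ h₃ i => .ext_left _ (Triangle.shift_distinguished T hT i) (h₁ i) (h₃ i))
    (fun J A hA i => .of_cofan (isColimitCofanMkObjOfIsColimit (shiftFunctor C i) _ _
      (coproductIsCoproduct A)) fun j => hA j i)
  have := hK P hP h 0
  exact (IsZero.iff_id_eq_zero K).2
    (this.of_iso ((shiftFunctorZero C ℤ).app K) (Iso.refl _) (𝟙 K))

/-- The connecting morphism of such an extension vanishes, so the extension is a direct sum and its
two factors can be exchanged. -/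
lemma extensionProduct_le_of_homVanishes {P Q : ObjectProperty C}
    (h : ∀ X Y, P X → Q Y → HomVanishes X (Y⟦(1 : ℤ)⟧)) :
    Q.extensionProduct P ≤ P.extensionProduct Q := by
  rintro E ⟨Y, X, f, g, k, hT, hY, hX⟩
  obtain ⟨e, -, -⟩ := exists_iso_binaryBiproduct_of_distTriang _ hT (h X Y hX hY k)
  exact ObjectProperty.prop_of_iso _ (biprod.braiding X Y ≪≫ e.symm)
    ⟨X, Y, _, _, _, binaryBiproductTriangle_distinguished X Y, hX, hY⟩

/-- By associativity (P*Q)*(P*Q) = P*(Q*P)*Q ⊆ P*(P*Q)*Q = (P*P)*(Q*Q) ⊆ P*Q. This makes weight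
decompositions pass to extensions. -/
lemma extensionProduct_closed [IsTriangulated C] {P Q : ObjectProperty C}
    [P.IsTriangulatedClosed₂] [P.IsClosedUnderIsomorphisms]
    [Q.IsTriangulatedClosed₂] [Q.IsClosedUnderIsomorphisms]
    (h : ∀ X Y, P X → Q Y → HomVanishes X (Y⟦(1 : ℤ)⟧)) :
    (P.extensionProduct Q).extensionProduct (P.extensionProduct Q) ≤ P.extensionProduct Q := by
  rw [ObjectProperty.extensionProduct_assoc, ← ObjectProperty.extensionProduct_assoc Q P Q]
  refine (ObjectProperty.monotone_extensionProduct_right _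
    (ObjectProperty.monotone_extensionProduct_left _ (extensionProduct_le_of_homVanishes h))).trans ?_
  rw [ObjectProperty.extensionProduct_assoc P Q Q, ← ObjectProperty.extensionProduct_assoc P P]
  exact (ObjectProperty.monotone_extensionProduct_left _
    (ObjectProperty.extensionProduct_le_of_isTriangulatedClosed₂ le_rfl le_rfl)).trans
    (ObjectProperty.monotone_extensionProduct_right _
    (ObjectProperty.extensionProduct_le_of_isTriangulatedClosed₂ le_rfl le_rfl))

end

/-! ### Cones and weight decompositions. -/

section

variable {C : Type u} [Category.{v} C] [Preadditive C] [HasZeroObject C] [HasShift C ℤ]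
  [∀ n : ℤ, (shiftFunctor C n).Additive] [Pretriangulated C]

lemma exists_lift₁ {A B K X : C} {f : A ⟶ B} {g : B ⟶ K} {h : K ⟶ A⟦(1 : ℤ)⟧}
    (hT : Triangle.mk f g h ∈ distTriang C) (u : X ⟶ B) (hu : u ≫ g = 0) :
    ∃ v : X ⟶ A, v ≫ f = u :=
  (Triangle.coyoneda_exact₂ _ hT u hu).imp fun _ => Eq.symm

lemma exists_lift₂ {A B K X : C} {f : A ⟶ B} {g : B ⟶ K} {h : K ⟶ A⟦(1 : ℤ)⟧}
    (hT : Triangle.mk f g h ∈ distTriang C) (u : X ⟶ K) (hu : u ≫ h = 0) :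
    ∃ v : X ⟶ B, v ≫ g = u :=
  (Triangle.coyoneda_exact₃ _ hT u hu).imp fun _ => Eq.symm

lemma exists_desc₂ {A B K X : C} {f : A ⟶ B} {g : B ⟶ K} {h : K ⟶ A⟦(1 : ℤ)⟧}
    (hT : Triangle.mk f g h ∈ distTriang C) (u : B ⟶ X) (hu : f ≫ u = 0) :
    ∃ v : K ⟶ X, g ≫ v = u :=
  (Triangle.yoneda_exact₂ _ hT u hu).imp fun _ => Eq.symm

lemma exists_desc₃ {A B K X : C} {f : A ⟶ B} {g : B ⟶ K} {h : K ⟶ A⟦(1 : ℤ)⟧}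
    (hT : Triangle.mk f g h ∈ distTriang C) (u : K ⟶ X) (hu : g ≫ u = 0) :
    ∃ v : A⟦(1 : ℤ)⟧ ⟶ X, h ≫ v = u :=
  (Triangle.yoneda_exact₃ _ hT u hu).imp fun _ => Eq.symm

omit [HasZeroObject C] [Pretriangulated C] in
lemma eq_zero_of_comp_shift_map {P Q : C} {φ : P ⟶ Q} {X : C} {i j : ℤ} (hij : j + 1 = i)
    (inj : ∀ g : X⟦j⟧ ⟶ P, g ≫ φ = 0 → g = 0) (f : X⟦i⟧ ⟶ P⟦(1 : ℤ)⟧) (hf : f ≫ φ⟦1⟧' = 0) :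
    f = 0 := by
  let e := (shiftFunctorAdd' C j 1 i hij).app X
  obtain ⟨g, hg⟩ := (shiftFunctor C (1 : ℤ)).map_surjective (e.inv ≫ f)
  have hg' : g = 0 := inj g ((shiftFunctor C (1 : ℤ)).map_injective (by
    rw [Functor.map_comp, hg, Category.assoc, hf, comp_zero, Functor.map_zero]))
  rw [← cancel_epi e.inv, comp_zero, ← hg, hg', Functor.map_zero]

lemma homVanishes_cone {P Q K : C} {φ : P ⟶ Q} {ψ : Q ⟶ K} {δ : K ⟶ P⟦(1 : ℤ)⟧}
    (hT : Triangle.mk φ ψ δ ∈ distTriang C) {X : C} {i j : ℤ} (hij : j + 1 = i)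
    (surj : ∀ g : X⟦i⟧ ⟶ Q, ∃ g', g = g' ≫ φ)
    (inj : ∀ g : X⟦j⟧ ⟶ P, g ≫ φ = 0 → g = 0) : HomVanishes (X⟦i⟧) K := fun f => by
  have h₃₁ : δ ≫ φ⟦1⟧' = 0 := comp_distTriang_mor_zero₃₁ _ hT
  have h : f ≫ δ = 0 :=
    eq_zero_of_comp_shift_map hij inj _ (by rw [Category.assoc, h₃₁, comp_zero])
  obtain ⟨g, rfl⟩ := exists_lift₂ hT f h
  obtain ⟨g', rfl⟩ := surj g
  have h₁₂ : φ ≫ ψ = 0 := comp_distTriang_mor_zero₁₂ _ hT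
  rw [Category.assoc, h₁₂, comp_zero]

lemma eq_zero_of_comp_mor₁ {T : Triangle C} (hT : T ∈ distTriang C) {X : C} {i j : ℤ}
    (hij : j + 1 = i) (h : HomVanishes (X⟦i⟧) T.obj₃) (g : X⟦j⟧ ⟶ T.obj₁)
    (hg : g ≫ T.mor₁ = 0) : g = 0 := by
  have h' : HomVanishes (X⟦j⟧) (T.obj₃⟦(-1 : ℤ)⟧) := h.shift_add (-1) (by omega)
  obtain ⟨k, rfl⟩ := Triangle.coyoneda_exact₂ _ (inv_rot_of_distTriang _ hT) g hg
  exact (congrArg (· ≫ _) (h' k)).trans zero_comp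

lemma localizingClosure_cone {D : ObjectProperty C} {T : Triangle C} (hT : T ∈ distTriang C)
    (h₁ : localizingClosure D T.obj₁) (h₂ : localizingClosure D T.obj₂) :
    localizingClosure D T.obj₃ :=
  (localizingClosure D).ext_of_isTriangulatedClosed₃ T hT h₁ h₂

variable [HasCoproducts.{v} C]

/-- The cone is not compared with the coproduct of the cones: its weight is tested on shifts of
compact objects, where surjectivity and injectivity reduce to the individual triangles. -/
lemma weightGE_cone_coproduct {H : ObjectProperty C} (hH : H ≤ compactObjects C) {n : ℤ}
    {J : Type v} (T : J → Triangle C) (hT : ∀ j, T j ∈ distTriang C)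
    (h₃ : ∀ j, weightGE H n (T j).obj₃) {B : C} {g : ∐ (fun j => (T j).obj₂) ⟶ B} {h}
    (hB : Triangle.mk (Limits.Sigma.map fun j => (T j).mor₁) g h ∈ distTriang C) :
    weightGE H n B := by
  classical
  intro X hX i hi
  refine homVanishes_cone hB (j := i - 1) (by omega) (fun g => ?_) (fun g hg => ?_)
  · refine hom_induction_of_compact (hH X hX) i (coproductIsCoproduct _)
      (p := fun g => ∃ g', g = g' ≫ Limits.Sigma.map fun j => (T j).mor₁) ?_ ?_ ?_ g
    · intro j a
      obtain ⟨b, rfl⟩ := (T j).coyoneda_exact₂ (hT j) a (h₃ j X hX i hi _)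
      exact ⟨b ≫ Sigma.ι (fun j => (T j).obj₁) j, by simp⟩
    · exact ⟨0, by simp⟩
    · rintro _ _ ⟨a, rfl⟩ ⟨b, rfl⟩
      exact ⟨a + b, by simp⟩
  · refine hom_ext_of_compact (hH X hX) fun j => ?_
    rw [zero_comp]
    refine eq_zero_of_comp_mor₁ (hT j) (i := i) (by omega) (h₃ j X hX i hi) _ ?_
    have : Sigma.π (fun j => (T j).obj₁) j ≫ (T j).mor₁ =
        Limits.Sigma.map (fun j => (T j).mor₁) ≫ Sigma.π (fun j => (T j).obj₂) j := by
      ext k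
      by_cases hk : k = j
      · subst hk
        simp
      · simp [Sigma.ι_π_of_ne_assoc _ hk, Sigma.ι_π_of_ne _ hk]
    rw [Category.assoc, this]
    rw [reassoc_of% hg, zero_comp]

/-- Weight decompositions of the objects of the localizing subcategory generated by a class of
compact objects of a negative subcategory. -/
lemma exists_weight_decomposition [IsTriangulated C] {D H : ObjectProperty C} (hD : D ≤ H)
    (hH : H ≤ compactObjects C) (hneg : IsNegativeSubcategory H) {F : C}
    (hF : localizingClosure D F) (n : ℤ) :
    (weightLE D n ⊓ localizingClosure D).extensionProduct
      (weightGE H (n + 1) ⊓ localizingClosure D) F := by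
  let P : ObjectProperty C := fun F => ∀ n, (weightLE D n ⊓ localizingClosure D).extensionProduct
    (weightGE H (n + 1) ⊓ localizingClosure D) F
  have hL : ∀ n, (weightLE D n ⊓ localizingClosure D).ContainsZero := fun n =>
    ⟨0, isZero_zero C, weightLE_of_isZero (isZero_zero C), ObjectProperty.prop_zero _⟩
  have hR : ∀ n, (weightGE H (n + 1) ⊓ localizingClosure D).ContainsZero := fun n =>
    ⟨0, isZero_zero C, weightGE_of_isZero (isZero_zero C), ObjectProperty.prop_zero _⟩
  have : P.IsClosedUnderIsomorphisms := ⟨fun e h n => ObjectProperty.prop_of_iso _ e (h n)⟩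
  refine hF P (.of_closed ?_ ?_ ?_ ?_) ?_ n
  · exact fun n => ObjectProperty.le_extensionProduct_left _ _ (ObjectProperty.prop_zero _)
  · intro X a hX n
    obtain ⟨A, B, f, g, h, hT, ⟨hA, hA'⟩, ⟨hB, hB'⟩⟩ := hX (n - a)
    exact ⟨_, _, _, _, _, Triangle.shift_distinguished _ hT a,
      ⟨weightLE_shift hA (sub_add_cancel n a), (localizingClosure D).le_shift a _ hA'⟩,
      ⟨weightGE_shift hB (by change n - a + 1 + a = n + 1; omega), (localizingClosure D).le_shift a _ hB'⟩⟩
  · intro T hT h₁ h₃ n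
    refine extensionProduct_closed (fun X Y hX hY => ?_) _ ⟨_, _, _, _, _, hT, h₁ n, h₃ n⟩
    exact hX.1 _ (weightGE_le_of_le hD _ _
      (weightGE_antitone (by omega) _ (weightGE_shift hY.1 rfl)))
  · intro J A hA n
    choose P Q f g h hT hP hQ using fun j => hA j n
    obtain ⟨B, g', h', hB⟩ := distinguished_cocone_triangle (Limits.Sigma.map f)
    have hP' := localizingClosure_coproduct fun j => (hP j).2
    exact ⟨_, _, _, _, _, hB, ⟨weightLE_coproduct fun j => (hP j).1, hP'⟩,
      ⟨weightGE_cone_coproduct hH (fun j => Triangle.mk (f j) (g j) (h j)) hT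
        (fun j => (hQ j).1) hB, localizingClosure_cone hB hP'
          (localizingClosure_coproduct fun j =>
            (localizingClosure D).ext_of_isTriangulatedClosed₂ _ (hT j) (hP j).2 (hQ j).2)⟩⟩
  · intro X hX n
    have e := (shiftFunctorZero C ℤ).app X
    by_cases hn : 0 ≤ n
    · exact ObjectProperty.le_extensionProduct_left _ _ ⟨ObjectProperty.prop_of_iso _ e
        (weightLE_shift_of_mem hX hn), le_localizingClosure D _ hX⟩
    · exact ObjectProperty.le_extensionProduct_right _ _ ⟨ObjectProperty.prop_of_iso _ e
        (weightGE_shift_of_mem hneg (hD _ hX) (by omega)), le_localizingClosure D _ hX⟩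

end

/-! ### Shifts of the weight classes. -/

section

variable {C : Type u} [Category.{v} C] [HasShift C ℤ]

lemma shiftedClass_iff (P : ObjectProperty C) [P.IsClosedUnderIsomorphisms] (i : ℤ) (X : C) :
    shiftedClass P i X ↔ P (X⟦-i⟧) := by
  constructor
  · intro h
    obtain ⟨Y, hY, ⟨e⟩⟩ := (ObjectProperty.prop_map_iff _ _ _).1 h
    exact P.prop_of_iso (((shiftFunctorCompIsoId C i (-i) (by simp)).app Y).symm ≪≫
      (shiftFunctor C (-i)).mapIso e) hY
  · intro h
    exact (ObjectProperty.prop_map_iff _ _ _).2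
      ⟨_, h, ⟨(shiftFunctorCompIsoId C (-i) i (by simp)).app X⟩⟩

variable [Preadditive C]

lemma rightOrthogonal_negative_shifts (H : ObjectProperty C) :
    (ObjectProperty.rightOrthogonal fun X => ∃ i : ℤ, 0 < i ∧ shiftedClass H (-i) X) =
      weightGE H 0 := by
  ext Y
  constructor
  · intro h X hX i hi f
    exact h f ⟨-i, by omega, by
      rw [neg_neg]
      exact ObjectProperty.prop_map_obj H (shiftFunctor C i) hX⟩
  · rintro h X f ⟨i, hi, hX⟩
    obtain ⟨Z, hZ, ⟨e⟩⟩ := (ObjectProperty.prop_map_iff _ _ _).1 hX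
    exact (h Z hZ (-i) (by omega)).of_iso e (Iso.refl _) f

variable [∀ n : ℤ, (shiftFunctor C n).Additive]

lemma shiftedClass_weightGE (D : ObjectProperty C) {n i m : ℤ} (h : n + i = m) :
    shiftedClass (weightGE D n) i = weightGE D m := by
  ext X
  rw [shiftedClass_iff]
  exact ⟨fun hX => ObjectProperty.prop_of_iso _
    ((shiftFunctorCompIsoId C (-i) i (by simp)).app X) (weightGE_shift hX h),
    fun hX => weightGE_shift hX (by omega)⟩

lemma shiftedClass_weightLE (D : ObjectProperty C) {n i m : ℤ} (h : n + i = m) :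
    shiftedClass (weightLE D n) i = weightLE D m := by
  ext X
  rw [shiftedClass_iff]
  exact ⟨fun hX => ObjectProperty.prop_of_iso _
    ((shiftFunctorCompIsoId C (-i) i (by simp)).app X) (weightLE_shift hX h),
    fun hX => weightLE_shift hX (by omega)⟩

end

/-! ### The weight structure generated by `H`. -/

section

variable {C : Type u} [Category.{v} C] [Preadditive C] [HasZeroObject C] [HasShift C ℤ]
  [∀ n : ℤ, (shiftFunctor C n).Additive] [Pretriangulated C]

/-- If M is orthogonal to the positive part, the map M → Y of a decomposition vanishes and M is a
retract of X. Hence a weight structure is determined by `ge`. -/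
lemma WeightStructure.le_eq_leftOrthogonal (w : WeightStructure C) :
    w.le = (shiftedClass w.ge 1).leftOrthogonal := by
  refine le_antisymm w.orthogonal fun M hM => ?_
  obtain ⟨X, Y, f, g, h, hT, hX, hY⟩ := w.exists_decomposition M
  obtain ⟨s, hs⟩ := Triangle.coyoneda_exact₂ _ hT (𝟙 M) ((Category.id_comp _).trans (hM g hY))
  exact w.le_retracts.of_retract ⟨s, f, hs.symm⟩ hX

lemma WeightStructure.eq_of_ge_eq {w w' : WeightStructure C} (h : w.ge = w'.ge) : w = w' := by
  have h' : w.le = w'.le := by rw [w.le_eq_leftOrthogonal, w'.le_eq_leftOrthogonal, h]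
  cases w
  cases w'
  cases h
  cases h'
  rfl

lemma WeightStructure.IsGeneratedBy.ge_eq {w : WeightStructure C} {H : ObjectProperty C}
    (hw : w.IsGeneratedBy H) : w.ge = weightGE H 0 :=
  hw.trans (rightOrthogonal_negative_shifts H)

lemma WeightStructure.IsGeneratedBy.le_eq {w : WeightStructure C} {H : ObjectProperty C}
    (hw : w.IsGeneratedBy H) : w.le = weightLE H 0 := by
  rw [w.le_eq_leftOrthogonal, hw.ge_eq, shiftedClass_weightGE H (zero_add 1)]
  ext X
  exact ⟨fun h Y hY f => h f hY, fun h Y f hY => h Y hY f⟩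

lemma existsUnique_isGeneratedBy [HasCoproducts.{v} C] [IsTriangulated C] {H : ObjectProperty C}
    (hneg : IsNegativeSubcategory H) (hgen : IsCompactlyGeneratedBy H) :
    ∃! w : WeightStructure C, w.IsGeneratedBy H := by
  have hge := shiftedClass_weightGE H (zero_add 1)
  have hle := shiftedClass_weightLE H (zero_add 1)
  refine ⟨{
    le := weightLE H 0
    ge := weightGE H 0
    le_retracts := inferInstance
    ge_retracts := inferInstance
    le_shift := by rw [hle]; exact weightLE_monotone (by omega)
    shift_ge := by rw [hge]; exact weightGE_antitone (by omega)
    orthogonal := by rw [hge]; exact fun X hX Y f hY => hX Y hY f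
    exists_decomposition := fun M => by
      obtain ⟨X, Y, f, g, h, hT, hX, hY⟩ := exists_weight_decomposition le_rfl hgen.le_compact hneg
        (F := M) (by rw [hgen.generates]; trivial) 0
      exact ⟨X, Y, f, g, h, hT, hX.1, by rw [hge]; exact hY.1⟩ },
    (rightOrthogonal_negative_shifts H).symm, fun w hw => ?_⟩
  exact WeightStructure.eq_of_ge_eq hw.ge_eq

end

/-! ### Verdier quotients by localizing subcategories. -/

section

variable {C : Type u} [Category.{v} C] [Preadditive C] [HasZeroObject C] [HasShift C ℤ]
  [∀ n : ℤ, (shiftFunctor C n).Additive] [Pretriangulated C] [HasCoproducts.{v} C]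

/-- Localizing subcategories are closed under retracts, by the Eilenberg swindle. -/
lemma localizingClosure_of_retract {D : ObjectProperty C} {M E : C} (r : Retract M E)
    (hE : localizingClosure D E) : localizingClosure D M := by
  let A : ULift.{v} ℕ → C := fun _ => E
  let ι : ℕ → (E ⟶ ∐ A) := fun k => Sigma.ι A ⟨k⟩
  have hom_ext : ∀ {Z : C} (f g : ∐ A ⟶ Z), (∀ k, ι k ≫ f = ι k ≫ g) → f = g :=
    fun f g h => Limits.Sigma.hom_ext _ _ fun ⟨k⟩ => h k
  have desc : ∀ {Z : C} (f : ℕ → (E ⟶ Z)), ∃ g : ∐ A ⟶ Z, ∀ k, ι k ≫ g = f k :=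
    fun f => ⟨Sigma.desc fun k => f k.down, fun k => by simp [ι]⟩
  -- With e the idempotent of E cutting out M, `u` fixes the 1 - e part of each copy of E and moves
  -- the e part to the next copy. It is split by `ρ`, and its cokernel is the copy of M in position
  -- 0, seen by `v`.
  obtain ⟨u, hu⟩ := desc fun k => ι k - r.r ≫ r.i ≫ ι k + r.r ≫ r.i ≫ ι (k + 1)
  obtain ⟨ρ, hρ⟩ := desc fun k => ι k - r.r ≫ r.i ≫ ι k +
    Nat.casesOn k 0 fun l => r.r ≫ r.i ≫ ι l
  obtain ⟨v, hv⟩ := desc fun k => Nat.casesOn k r.r fun _ => (0 : E ⟶ M)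
  have huρ : u ≫ ρ = 𝟙 _ := hom_ext _ _ fun k => by
    rw [reassoc_of% hu k]
    cases k <;> simp [hρ]
  have hvu : v ≫ r.i ≫ ι 0 + ρ ≫ u = 𝟙 _ := hom_ext _ _ fun k => by
    rw [Preadditive.comp_add, reassoc_of% hv k, reassoc_of% hρ k]
    cases k <;> simp [hu]
  have huv : u ≫ v = 0 := hom_ext _ _ fun k => by
    rw [reassoc_of% hu k]
    cases k <;> simp [hv]
  obtain ⟨K, c, δ, hT⟩ := distinguished_cocone_triangle u
  obtain ⟨v', rfl⟩ := exists_desc₂ hT v huv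
  have hc : u ≫ c = 0 := comp_distTriang_mor_zero₁₂ _ hT
  have hδ : δ = 0 := by
    have h : δ ≫ u⟦1⟧' = 0 := comp_distTriang_mor_zero₃₁ _ hT
    rw [← Category.comp_id δ, ← (shiftFunctor C (1 : ℤ)).map_id, ← huρ,
      Functor.map_comp, reassoc_of% h, zero_comp]
  have h₁ : (r.i ≫ ι 0 ≫ c) ≫ v' = 𝟙 M := by simp [hv 0]
  have h₂ : v' ≫ r.i ≫ ι 0 ≫ c = 𝟙 K := by
    have : c ≫ (v' ≫ r.i ≫ ι 0 ≫ c - 𝟙 K) = 0 := by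
      have := congr($hvu ≫ c)
      simp only [Preadditive.add_comp, Category.assoc, hc, comp_zero, add_zero,
        Category.id_comp] at this
      rw [Preadditive.comp_sub, this, Category.comp_id, sub_self]
    obtain ⟨x, hx⟩ := exists_desc₃ hT _ this
    rwa [hδ, zero_comp, eq_comm, sub_eq_zero] at hx
  have hA : localizingClosure D (∐ A) := localizingClosure_coproduct fun _ => hE
  exact ObjectProperty.prop_of_iso _ ⟨v', r.i ≫ ι 0 ≫ c, h₂, h₁⟩ (localizingClosure_cone hT hA hA)

variable [IsTriangulated C] {D : ObjectProperty C}

omit [HasCoproducts.{v} C] in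
lemma isZero_verdierFunctor_obj {Z : C} (hZ : localizingClosure D Z) :
    IsZero ((verdierFunctor (localizingClosure D)).obj Z) := by
  have : (localizingClosure D).trW (0 : Z ⟶ 0) :=
    ObjectProperty.trW.mk' _ (contractible_distinguished Z) hZ
  have := Localization.inverts (verdierFunctor (localizingClosure D)) _ _ this
  exact ((verdierFunctor (localizingClosure D)).map_isZero (isZero_zero C)).of_iso
    (asIso ((verdierFunctor (localizingClosure D)).map (0 : Z ⟶ 0)))

/-- The identity of M is killed by some s whose cone lies in the subcategory; so s = 0, and M[1]
splits off that cone. -/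
lemma localizingClosure_of_isZero {M : C}
    (hM : IsZero ((verdierFunctor (localizingClosure D)).obj M)) : localizingClosure D M := by
  obtain ⟨Z, s, ⟨K, g, h, hT, hK⟩, hs⟩ := (MorphismProperty.map_eq_iff_postcomp
    (verdierFunctor (localizingClosure D)) (localizingClosure D).trW (𝟙 M) 0).1
    (hM.eq_of_src _ _)
  rw [Category.id_comp, zero_comp] at hs
  subst hs
  obtain ⟨t, ht⟩ := Triangle.coyoneda_exact₁ _ hT (𝟙 (M⟦(1 : ℤ)⟧))
    ((Category.id_comp _).trans (Functor.map_zero _ _ _))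
  exact (ObjectProperty.prop_shift_iff_of_isStableUnderShift _ M (1 : ℤ)).1
    (localizingClosure_of_retract ⟨t, h, ht.symm⟩ hK)

omit [HasCoproducts.{v} C] in
lemma exists_factorization_of_verdierFunctor_map_eq_zero {X Y : C} {f : X ⟶ Y}
    (hf : (verdierFunctor (localizingClosure D)).map f = 0) :
    ∃ (Z : C) (_ : localizingClosure D Z) (a : X ⟶ Z) (b : Z ⟶ Y), a ≫ b = f := by
  obtain ⟨Y', s, hs, h⟩ := (MorphismProperty.map_eq_iff_postcomp
    (verdierFunctor (localizingClosure D)) (localizingClosure D).trW f 0).1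
    (by rw [hf, Functor.map_zero])
  obtain ⟨Z, b, δ, hT, hZ⟩ := (ObjectProperty.trW_iff' _ _).1 hs
  obtain ⟨a, ha⟩ := exists_lift₁ hT f (by rw [h, zero_comp])
  exact ⟨Z, hZ, a, b, ha⟩

/-- The Verdier localization by a localizing subcategory sends the inclusions into a coproduct
to a jointly epimorphic family. -/
lemma verdierFunctor_eq_zero_of_coproduct {J : Type v} {A : J → C} {c : Cofan A}
    (hc : IsColimit c) {Y : C}
    (f : (verdierFunctor (localizingClosure D)).obj c.pt ⟶
      (verdierFunctor (localizingClosure D)).obj Y)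
    (hf : ∀ j, (verdierFunctor (localizingClosure D)).map (c.inj j) ≫ f = 0) : f = 0 := by
  let π := verdierFunctor (localizingClosure D)
  obtain ⟨φ, hφ⟩ := Localization.exists_leftFraction π (localizingClosure D).trW f
  have hs := Localization.inverts π _ _ φ.hs
  have hfs : f ≫ π.map φ.s = π.map φ.f := by rw [hφ, MorphismProperty.LeftFraction.map_comp_map_s]
  have h₀ : ∀ j, π.map (c.inj j ≫ φ.f) = 0 := fun j => by
    rw [Functor.map_comp, ← hfs, reassoc_of% (hf j), zero_comp]
  choose Z hZ a b hab using fun j => exists_factorization_of_verdierFunctor_map_eq_zero (h₀ j)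
  -- The separate factorizations assemble into one through ∐ Z, which π kills because the
  -- subcategory is closed under coproducts.
  have : φ.f = Cofan.IsColimit.desc hc (fun j => a j ≫ Sigma.ι Z j) ≫ Sigma.desc b :=
    Cofan.IsColimit.hom_ext hc _ _ fun j => by simp [hab]
  rw [← cancel_mono (π.map φ.s), hfs, zero_comp, this, Functor.map_comp,
    (isZero_verdierFunctor_obj (localizingClosure_coproduct hZ)).eq_of_tgt (π.map _) 0, zero_comp]

variable {H : ObjectProperty C} {n : ℤ}

/-- Morphisms in the Verdier quotient from `weightLE H n` to `weightGE H n` lift to `C`. -/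
lemma verdierFunctor_map_surjective_of_weight (hD : D ≤ H)
    (hH : H ≤ compactObjects C) (hneg : IsNegativeSubcategory H) {A Y : C} (hA : weightLE H n A)
    (hY : weightGE H n Y) (f : (verdierFunctor (localizingClosure D)).obj A ⟶
      (verdierFunctor (localizingClosure D)).obj Y) :
    ∃ g : A ⟶ Y, (verdierFunctor (localizingClosure D)).map g = f := by
  let π := verdierFunctor (localizingClosure D)
  obtain ⟨φ, hφ⟩ := Localization.exists_leftFraction π (localizingClosure D).trW f
  have hfs : f ≫ π.map φ.s = π.map φ.f := by rw [hφ, MorphismProperty.LeftFraction.map_comp_map_s]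
  obtain ⟨F, u, δ, hT, hF⟩ := (ObjectProperty.trW_iff' _ _).1 φ.hs
  obtain ⟨A', B', a, b, δ', hT', ⟨hA', -⟩, ⟨hB', hB''⟩⟩ :=
    exists_weight_decomposition hD hH hneg hF (n - 1)
  rw [sub_add_cancel] at hB'
  -- The part of F of weight ≤ n - 1 maps trivially to Y, so F may be replaced by its part of weight
  -- ≥ n, and the denominator `φ.s` by the further map `t` out of Y.
  obtain ⟨c, hc⟩ := exists_desc₂ hT' u
    (weightLE_le_of_le hD _ _ hA' Y (by rwa [sub_add_cancel]) _)
  obtain ⟨Y'', t, δ'', hT''⟩ := distinguished_cocone_triangle c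
  have hct : c ≫ t = 0 := comp_distTriang_mor_zero₁₂ _ hT''
  obtain ⟨t', ht'⟩ := exists_desc₂ hT t (by rw [← hc, Category.assoc, hct, comp_zero])
  -- The obstruction to lifting along `t` is a morphism from A to B'[1], of weight ≥ n + 1.
  obtain ⟨g, hg⟩ := exists_lift₂ hT'' (φ.f ≫ t') (hA _ (weightGE_shift hB' rfl) _)
  have ht : IsIso (π.map t) := Localization.inverts π _ _ (ObjectProperty.trW.mk' (localizingClosure D) hT'' hB'')
  refine ⟨g, ?_⟩
  rw [← cancel_mono (π.map t), ← Functor.map_comp, hg, Functor.map_comp, ← hfs, Category.assoc,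
    ← Functor.map_comp, ht']

lemma homVanishes_verdierFunctor_of_weight (hD : D ≤ H) (hH : H ≤ compactObjects C)
    (hneg : IsNegativeSubcategory H) {A Y : C} (hA : weightLE H n A)
    (hY : weightGE H (n + 1) Y) : HomVanishes ((verdierFunctor (localizingClosure D)).obj A)
      ((verdierFunctor (localizingClosure D)).obj Y) := fun f => by
  obtain ⟨g, rfl⟩ := verdierFunctor_map_surjective_of_weight hD hH hneg hA
    (weightGE_antitone (by omega) _ hY) f
  rw [hA Y hY g, Functor.map_zero]

end

/-! ### The induced weight structure and the hearts of the subcategories. -/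

section

variable {C D : Type*} [Category* C] [Category* D] [HasShift C ℤ] [HasShift D ℤ]
  (F : C ⥤ D) [F.CommShift ℤ]

lemma shiftedClass_retractClosure_map (P : ObjectProperty C) (i : ℤ) :
    shiftedClass (P.map F).retractClosure i = ((shiftedClass P i).map F).retractClosure := by
  ext X
  rw [shiftedClass_iff]
  constructor
  · rintro ⟨N, hN, ⟨r⟩⟩
    obtain ⟨Y, hY, ⟨e⟩⟩ := (ObjectProperty.prop_map_iff _ _ _).1 hN
    exact ⟨_, ObjectProperty.prop_map_obj _ F
      (ObjectProperty.prop_map_obj P (shiftFunctor C i) hY),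
      ⟨((shiftFunctorCompIsoId D (-i) i (by simp)).app X).symm.retract.trans
        ((r.map (shiftFunctor D i)).trans ((shiftFunctor D i).mapIso e.symm ≪≫
          ((F.commShiftIso i).app Y).symm).retract)⟩⟩
  · rintro ⟨N, hN, ⟨r⟩⟩
    obtain ⟨Z, hZ, ⟨e⟩⟩ := (ObjectProperty.prop_map_iff _ _ _).1 hN
    obtain ⟨Y, hY, ⟨e'⟩⟩ := (ObjectProperty.prop_map_iff _ _ _).1 hZ
    refine ⟨_, ObjectProperty.prop_map_obj P F hY,
      ⟨(r.map (shiftFunctor D (-i))).trans ((shiftFunctor D (-i)).mapIso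
        (e.symm ≪≫ F.mapIso e'.symm) ≪≫ ((F.commShiftIso (-i)).app _).symm ≪≫
        F.mapIso ((shiftFunctorCompIsoId C i (-i) (by simp)).app Y)).retract⟩⟩

end

section

variable {C : Type u} [Category.{v} C] [Preadditive C] [HasZeroObject C] [HasShift C ℤ]
  [∀ n : ℤ, (shiftFunctor C n).Additive] [Pretriangulated C] [HasCoproducts.{v} C]
  [IsTriangulated C] {D H : ObjectProperty C} {n : ℤ}

lemma homVanishes_retractClosure_of_weight (hD : D ≤ H) (hH : H ≤ compactObjects C)
    (hneg : IsNegativeSubcategory H) {A Y : VerdierQuotient (localizingClosure D)}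
    (hA : ((weightLE H n).map (verdierFunctor (localizingClosure D))).retractClosure A)
    (hY : ((weightGE H (n + 1)).map (verdierFunctor (localizingClosure D))).retractClosure Y) :
    HomVanishes A Y := by
  obtain ⟨A', hA, ⟨r⟩⟩ := hA
  obtain ⟨Y', hY, ⟨r'⟩⟩ := hY
  obtain ⟨A'', hA, ⟨e⟩⟩ := (ObjectProperty.prop_map_iff _ _ _).1 hA
  obtain ⟨Y'', hY, ⟨e'⟩⟩ := (ObjectProperty.prop_map_iff _ _ _).1 hY
  exact (((homVanishes_verdierFunctor_of_weight hD hH hneg hA hY).of_iso e e').of_retract_left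
    r).of_retract_right r'

/-- The weight structure induced on the Verdier quotient by the localizing subcategory generated
by a subclass of `H`. -/
lemma exists_isInducedOnQuotient {w : WeightStructure C} (hw : w.IsGeneratedBy H)
    (hD : D ≤ H) (hH : H ≤ compactObjects C) (hneg : IsNegativeSubcategory H) :
    ∃ w' : WeightStructure (VerdierQuotient (localizingClosure D)),
      IsInducedOnQuotient w (localizingClosure D) w' := by
  let π := verdierFunctor (localizingClosure D)
  have hle := shiftedClass_retractClosure_map π w.le 1
  have hge := shiftedClass_retractClosure_map π w.ge 1
  have hge' : shiftedClass w.ge 1 = weightGE H 1 := by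
    rw [hw.ge_eq, shiftedClass_weightGE H (zero_add 1)]
  refine ⟨{
    le := (w.le.map π).retractClosure
    ge := (w.ge.map π).retractClosure
    le_retracts := inferInstance
    ge_retracts := inferInstance
    le_shift := by
      rw [hle]
      exact ObjectProperty.monotone_retractClosure (ObjectProperty.map_monotone w.le_shift π)
    shift_ge := by
      rw [hge]
      exact ObjectProperty.monotone_retractClosure (ObjectProperty.map_monotone w.shift_ge π)
    orthogonal := fun X hX Y f hY => by
      rw [hge, hge'] at hY
      rw [hw.le_eq] at hX
      exact homVanishes_retractClosure_of_weight hD hH hneg hX hY f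
    exists_decomposition := fun M => by
      have := Localization.essSurj π (localizingClosure D).trW
      obtain ⟨X, Y, f, g, h, hT, hX, hY⟩ := w.exists_decomposition (π.objPreimage M)
      refine ObjectProperty.prop_of_iso (ObjectProperty.extensionProduct _ _)
        (π.objObjPreimageIso M) ⟨_, _, _, _, _, π.map_distinguished _ hT,
        ObjectProperty.le_retractClosure _ _ (ObjectProperty.prop_map_obj _ π hX), ?_⟩
      rw [hge]
      exact ObjectProperty.le_retractClosure _ _ (ObjectProperty.prop_map_obj _ π hY) },
    rfl, rfl⟩

/-- The objects of the heart that belong to the localizing subcategory generated by `D` are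
retracts of coproducts of objects of `D`, up to a shift. -/
lemma exists_retract_coproduct_of_heart (hD : D ≤ H) (hH : H ≤ compactObjects C)
    (hsmall : ObjectProperty.EssentiallySmall.{v} (compactObjects C))
    (hneg : IsNegativeSubcategory H) {N : C} (hN : localizingClosure D N)
    (hle : weightLE H n N) (hge : weightGE H n N) :
    ∃ (J : Type v) (X : J → C), (∀ j, D (X j)) ∧ Nonempty (Retract N (∐ fun j => (X j)⟦n⟧)) := by
  have : ObjectProperty.EssentiallySmall.{v} D := .of_le (hD.trans hH)
  obtain ⟨D₀, hsmall₀, hD₀, hDD₀⟩ := ObjectProperty.EssentiallySmall.exists_small_le.{v} D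
  let X₀ : Shrink.{v} (Subtype D₀) → C := fun j => ((equivShrink (Subtype D₀)).symm j).1
  have hX₀ : ∀ j, D (X₀ j) := fun j => hD₀ _ ((equivShrink (Subtype D₀)).symm j).2
  let A : (Σ j, ((X₀ j)⟦n⟧ ⟶ N)) → C := fun j => (X₀ j.1)⟦n⟧
  let φ : ∐ A ⟶ N := Sigma.desc fun j => j.2
  obtain ⟨K, ψ, δ, hT⟩ := distinguished_cocone_triangle φ
  have hP : localizingClosure D (∐ A) := localizingClosure_coproduct fun j =>
    (localizingClosure D).le_shift n _ (le_localizingClosure D _ (hX₀ j.1))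
  have hK : localizingClosure D K := localizingClosure_cone hT hP hN
  -- For i = n every map to N is, up to isomorphism, one of the chosen components; below n there are
  -- no maps to N, nor any from lower shifts to ∐ A.
  have hK' : weightGE D (n + 1) K := fun X hX i hi => by
    refine homVanishes_cone hT (j := i - 1) (by omega) (fun g => ?_) fun g _ => ?_
    · by_cases hin : i < n
      · exact ⟨0, by rw [hge X (hD X hX) i hin g, zero_comp]⟩
      · obtain rfl : i = n := by omega
        obtain ⟨Y, hY, ⟨e⟩⟩ := hDD₀ X hX
        let y : Shrink.{v} (Subtype D₀) := equivShrink _ ⟨Y, hY⟩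
        have hy : X₀ y = Y := by simp [X₀, y]
        let e' : X ≅ X₀ y := e ≪≫ eqToIso hy.symm
        refine ⟨e'.hom⟦i⟧' ≫ Sigma.ι A ⟨y, e'.inv⟦i⟧' ≫ g⟩, ?_⟩
        simp [φ, A, ← Functor.map_comp_assoc]
    · have hP' : weightGE H n (∐ A) := weightGE_coproduct hH fun j =>
        weightGE_shift_of_mem hneg (hD _ (hX₀ j.1)) le_rfl
      exact hP' X (hD X hX) (i - 1) (by omega) g
  -- The bound on K is only relative to `D`, while `hle` needs one relative to `H`. Decomposing K
  -- makes it a retract of B', which has the stronger bound.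
  obtain ⟨A', B', a, b, δ', hT', ⟨hA', -⟩, ⟨hB', -⟩⟩ :=
    exists_weight_decomposition hD hH hneg hK n
  obtain ⟨t, ht⟩ := exists_desc₂ hT' (𝟙 K) (hA' K hK' _)
  have hψ : ψ = 0 := (hle B' hB').of_retract_right ⟨b, t, ht⟩ ψ
  obtain ⟨s, hs⟩ := exists_lift₁ hT (𝟙 N) (by rw [hψ, comp_zero])
  exact ⟨Σ j, ((X₀ j)⟦n⟧ ⟶ N), fun j => X₀ j.1, fun j => hX₀ j.1, ⟨s, φ, hs⟩⟩

end

/-! ### Homotopy colimits of weight truncations. -/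

section

variable {C : Type u} [Category.{v} C] [Preadditive C] [HasZeroObject C] [HasShift C ℤ]
  [∀ n : ℤ, (shiftFunctor C n).Additive] [Pretriangulated C] [HasCoproducts.{v} C]

/-- If `M` is filtered by objects `A k` whose "cofibres" `B k` receive no nonzero morphisms from the
shifts `X⟦i⟧` with `X` in `D` and `i ≤ k`, then `M` is the homotopy colimit of the `A k`. -/
lemma exists_telescope_triangle {D : ObjectProperty C} (hD : D ≤ compactObjects C) {M : C}
    (hM : localizingClosure D M) {A B : ℕ → C} {α : ∀ k, A k ⟶ M} {β : ∀ k, M ⟶ B k}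
    {γ : ∀ k, B k ⟶ (A k)⟦(1 : ℤ)⟧} (hT : ∀ k, Triangle.mk (α k) (β k) (γ k) ∈ distTriang C)
    (hA : ∀ k, localizingClosure D (A k)) (hB : ∀ k : ℕ, weightGE D ((k : ℤ) + 1) (B k))
    {s : ∀ k, A k ⟶ A (k + 1)} (hs : ∀ k, s k ≫ α (k + 1) = α k)
    {σ : ∐ (fun k : ULift.{v} ℕ => A k.down) ⟶ ∐ (fun k : ULift.{v} ℕ => A k.down)}
    (hσ : ∀ k, Sigma.ι (fun k : ULift.{v} ℕ => A k.down) ⟨k⟩ ≫ σ =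
      s k ≫ Sigma.ι (fun k : ULift.{v} ℕ => A k.down) ⟨k + 1⟩) :
    ∃ (p : ∐ (fun k : ULift.{v} ℕ => A k.down) ⟶ M) (δ : M ⟶ _),
      Triangle.mk (𝟙 _ - σ) p δ ∈ distTriang C ∧
      ∀ k, Sigma.ι (fun k : ULift.{v} ℕ => A k.down) ⟨k⟩ ≫ p = α k := by
  let A' : ULift.{v} ℕ → C := fun k => A k.down
  let ι : ∀ k : ℕ, A k ⟶ ∐ A' := fun k => Sigma.ι A' ⟨k⟩
  have hom_ext : ∀ {Z : C} (f g : ∐ A' ⟶ Z), (∀ k, ι k ≫ f = ι k ≫ g) → f = g :=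
    fun f g h => Limits.Sigma.hom_ext _ _ fun ⟨k⟩ => h k
  obtain ⟨T, p, δ, hp⟩ := distinguished_cocone_triangle (𝟙 (∐ A') - σ)
  let a : ∐ A' ⟶ M := Sigma.desc fun k => α k.down
  have ha : ∀ k, ι k ≫ a = α k := fun k => Sigma.ι_desc _ _
  obtain ⟨t, ht⟩ := exists_desc₂ hp a (hom_ext _ _ fun k => by
    rw [Preadditive.sub_comp, Preadditive.comp_sub, Category.id_comp, reassoc_of% (hσ k)]
    change _ - s k ≫ ι (k + 1) ≫ a = _
    rw [ha, ha, hs, sub_self, comp_zero])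
  have up : (𝟙 (∐ A') - σ) ≫ p = 0 := comp_distTriang_mor_zero₁₂ _ hp
  have δu : δ ≫ (𝟙 (∐ A') - σ)⟦1⟧' = 0 := comp_distTriang_mor_zero₃₁ _ hp
  have hιp : ∀ k, ι k ≫ p = s k ≫ ι (k + 1) ≫ p := fun k => by
    rw [Preadditive.sub_comp, sub_eq_zero, Category.id_comp] at up
    rw [← reassoc_of% (hσ k), ← up]
  -- If x = x ≫ σ, component 0 of x vanishes and component l + 1 is determined by component l, so
  -- all vanish.
  have hinj : ∀ (X : C) (_ : D X) (i : ℤ) (x : X⟦i⟧ ⟶ ∐ A'), x ≫ (𝟙 _ - σ) = 0 → x = 0 := by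
    intro X hX i x hx
    rw [Preadditive.comp_sub, Category.comp_id, sub_eq_zero] at hx
    refine hom_ext_of_compact (hD X hX) fun ⟨k⟩ => ?_
    rw [zero_comp]
    induction k with
    | zero =>
      have : σ ≫ Sigma.π A' ⟨0⟩ = 0 := hom_ext _ _ fun k => by
        rw [reassoc_of% (hσ k), comp_zero, Sigma.ι_π_of_ne _ (by simp), comp_zero]
      rw [hx, Category.assoc, this, comp_zero]
    | succ l ih =>
      have : σ ≫ Sigma.π A' ⟨l + 1⟩ = Sigma.π A' ⟨l⟩ ≫ s l := hom_ext _ _ fun k => by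
        rw [reassoc_of% (hσ k)]
        by_cases hk : k = l
        · subst hk
          rw [Sigma.ι_π_eq_id]
          exact (Category.comp_id _).trans
            ((Category.id_comp _).symm.trans (by rw [← Sigma.ι_π_eq_id A', Category.assoc]))
        · rw [Sigma.ι_π_of_ne _ (by simpa using hk), comp_zero]
          change _ = Sigma.ι A' ⟨k⟩ ≫ _
          rw [Sigma.ι_π_of_ne_assoc _ (by simpa using hk), zero_comp]
      rw [hx, Category.assoc, this, reassoc_of% ih, zero_comp]
  obtain ⟨K, ψ, ε, hK⟩ := distinguished_cocone_triangle t
  have hP : localizingClosure D (∐ A') := localizingClosure_coproduct fun k => hA k.down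
  have hK₀ : IsZero K := by
    refine isZero_of_homVanishes (localizingClosure_cone hK (localizingClosure_cone hp hP hP) hM)
      fun X hX i => homVanishes_cone hK (j := i - 1) (by omega) (fun g => ?_) fun g hg => ?_
    · obtain ⟨g', rfl⟩ := exists_lift₁ (hT i.toNat) g (hB i.toNat X hX i (by omega) _)
      exact ⟨g' ≫ ι i.toNat ≫ p, by simp [ht, ha]⟩
    · have h₀ : g ≫ δ = 0 := by
        refine eq_zero_of_comp_shift_map (j := i - 2) (by omega) (hinj X hX _) _ ?_
        rw [Category.assoc, δu, comp_zero]
      obtain ⟨g', rfl⟩ := exists_lift₂ hp g h₀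
      -- Asking for all large k makes the property additive and lets k be raised to `i.toNat` or
      -- more, where A k → M is injective on maps from X[i - 1].
      obtain ⟨k₀, hk₀⟩ : ∃ k₀ : ℕ, ∀ k ≥ k₀, ∃ b : X⟦i - 1⟧ ⟶ A k, g' ≫ p = b ≫ ι k ≫ p := by
        refine hom_induction_of_compact (hD X hX) (i - 1) (coproductIsCoproduct A')
          (p := fun g' => ∃ k₀ : ℕ, ∀ k ≥ k₀, ∃ b : X⟦i - 1⟧ ⟶ A k, g' ≫ p = b ≫ ι k ≫ p)
          ?_ ?_ ?_ g'
        · rintro ⟨l⟩ b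
          refine ⟨l, fun k hk => ?_⟩
          induction k, hk using Nat.le_induction with
          | base => exact ⟨b, Category.assoc _ _ _⟩
          | succ k _ ih =>
            obtain ⟨b', hb'⟩ := ih
            exact ⟨b' ≫ s k, by rw [hb', hιp k, Category.assoc]⟩
        · exact ⟨0, fun k _ => ⟨0, by simp⟩⟩
        · rintro x y ⟨k₁, h₁⟩ ⟨k₂, h₂⟩
          refine ⟨max k₁ k₂, fun k hk => ?_⟩
          obtain ⟨b₁, hb₁⟩ := h₁ k (le_trans (le_max_left _ _) hk)
          obtain ⟨b₂, hb₂⟩ := h₂ k (le_trans (le_max_right _ _) hk)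
          exact ⟨b₁ + b₂, by rw [Preadditive.add_comp, Preadditive.add_comp, hb₁, hb₂]⟩
      obtain ⟨b, hb⟩ := hk₀ (max k₀ i.toNat) (le_max_left _ _)
      have : b = 0 := by
        refine eq_zero_of_comp_mor₁ (hT (max k₀ i.toNat)) (i := i) (by omega)
          (hB _ X hX i (by omega)) b ?_
        change b ≫ α _ = 0
        rw [← ha, ← ht, ← Category.assoc (ι _), ← Category.assoc b, ← hb, hg]
      rw [hb, this, zero_comp]
  have : IsIso t := (Triangle.isZero₃_iff_isIso₁ _ hK).1 hK₀
  refine ⟨a, inv t ≫ δ, isomorphic_distinguished _ hp _ (Triangle.isoMk _ _ (Iso.refl _)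
    (Iso.refl _) (asIso t).symm ?_ ?_ ?_), ha⟩
  · exact (Category.comp_id _).trans (Category.id_comp _).symm
  · change a ≫ inv t = 𝟙 _ ≫ p
    rw [← ht, Category.assoc, IsIso.hom_inv_id, Category.comp_id, Category.id_comp]
  · change (inv t ≫ δ) ≫ (𝟙 _)⟦(1 : ℤ)⟧' = inv t ≫ δ
    rw [CategoryTheory.Functor.map_id, Category.comp_id]

end

/-! ### Orthogonality in the quotient in equal weights. -/

section

variable {C : Type u} [Category.{v} C] [Preadditive C] [HasZeroObject C] [HasShift C ℤ]
  [∀ n : ℤ, (shiftFunctor C n).Additive] [Pretriangulated C] [HasCoproducts.{v} C]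
  [IsTriangulated C] {H H₁ H₂ H₃ : ObjectProperty C}

/-- If the Verdier localization kills the morphisms from `H₁` to `H₂`, then it kills the morphisms
between coproducts of shifts of objects of `H₁` and `H₂` by the same integer. -/
lemma verdierFunctor_map_coproduct_eq_zero (hH₁ : H₁ ≤ compactObjects C)
    (hvanish : ∀ (X Y : C) (f : X ⟶ Y), H₁ X → H₂ Y →
      (verdierFunctor (localizingClosure H₃)).map f = 0) (n : ℤ)
    {J K : Type v} {X : J → C} {Y : K → C} (hX : ∀ j, H₁ (X j)) (hY : ∀ k, H₂ (Y k))
    (f : ∐ (fun j => (X j)⟦n⟧) ⟶ ∐ (fun k => (Y k)⟦n⟧)) :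
    (verdierFunctor (localizingClosure H₃)).map f = 0 := by
  let π := verdierFunctor (localizingClosure H₃)
  refine verdierFunctor_eq_zero_of_coproduct (coproductIsCoproduct fun j => (X j)⟦n⟧)
    _ fun j => ?_
  have key : ∀ g : (X j)⟦n⟧ ⟶ ∐ (fun k => (Y k)⟦n⟧), π.map g = 0 := by
    refine hom_induction_of_compact (hH₁ _ (hX j)) n (coproductIsCoproduct fun k => (Y k)⟦n⟧)
      (p := fun g => π.map g = 0) (fun k a => ?_) (π.map_zero _ _) fun g h hg hh => ?_
    · obtain ⟨b, rfl⟩ := (shiftFunctor C n).map_surjective a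
      have hb : π.map (b⟦n⟧') = 0 := by
        rw [← cancel_mono ((π.commShiftIso n).hom.app (Y k)), Functor.commShiftIso_hom_naturality,
          hvanish _ _ b (hX j) (hY k), Functor.map_zero, comp_zero, zero_comp]
      rw [Functor.map_comp, hb, zero_comp]
    · rw [Functor.map_add, hg, hh, add_zero]
  exact (π.map_comp _ _).symm.trans (key _)

/-- The orthogonality of `C₁` and `C₂` in the Verdier quotient in the same weight. -/
lemma homVanishes_verdierFunctor_of_vanish (hneg : IsNegativeSubcategory H)
    (hgen : IsCompactlyGeneratedBy H) (h₁ : H₁ ≤ H) (h₂ : H₂ ≤ H) (h₃ : H₃ ≤ H)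
    (hvanish : ∀ (X Y : C) (f : X ⟶ Y), H₁ X → H₂ Y →
      (verdierFunctor (localizingClosure H₃)).map f = 0) {n : ℤ} {A B : C}
    (hA : weightLE H n A) (hA₁ : localizingClosure H₁ A) (hB : weightGE H n B)
    (hB₂ : localizingClosure H₂ B) : HomVanishes ((verdierFunctor (localizingClosure H₃)).obj A)
      ((verdierFunctor (localizingClosure H₃)).obj B) := fun f => by
  let π := verdierFunctor (localizingClosure H₃)
  have hH := hgen.le_compact
  obtain ⟨g, rfl⟩ := verdierFunctor_map_surjective_of_weight h₃ hH hneg hA hB f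
  -- A₀ and B₀ are the weight n pieces of A and B; the remaining pieces do not interact, so the lift
  -- factors as A → A₀ → B₀ → B.
  obtain ⟨A', A₀, a, p, a', hT, ⟨hA', hA₁'⟩, hA₀, hA₀₁⟩ :=
    exists_weight_decomposition h₁ hH hneg hA₁ (n - 1)
  replace hA' := weightLE_le_of_le h₁ _ _ hA'
  have hA₀' : weightLE H n A₀ := (weightLE H n).ext_of_isTriangulatedClosed₂ _
    (rot_of_distTriang _ hT) hA (weightLE_shift hA' (sub_add_cancel n 1))
  obtain ⟨B₀, B', q, b, b', hT', ⟨hB₀, hB₀₂⟩, hB', hB₂'⟩ :=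
    exists_weight_decomposition h₂ hH hneg hB₂ n
  have hB₀' : weightGE H n B₀ := (weightGE H n).ext_of_isTriangulatedClosed₂ _
    (inv_rot_of_distTriang _ hT') (weightGE_shift hB' (add_neg_cancel_right n 1)) hB
  obtain ⟨g, rfl⟩ := exists_desc₂ hT g (hA' _ (by rwa [sub_add_cancel]) _)
  obtain ⟨g, rfl⟩ := exists_lift₁ hT' g (hA₀' _ hB' _)
  rw [sub_add_cancel] at hA₀
  obtain ⟨J, X, hX, ⟨r⟩⟩ := exists_retract_coproduct_of_heart h₁ hH hgen.essentiallySmall hneg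
    hA₀₁ hA₀' hA₀
  obtain ⟨K, Y, hY, ⟨r'⟩⟩ := exists_retract_coproduct_of_heart h₂ hH hgen.essentiallySmall hneg
    hB₀₂ (weightLE_le_of_le h₂ _ _ hB₀) hB₀'
  have hg : π.map (r.r ≫ g ≫ r'.i) = 0 :=
    verdierFunctor_map_coproduct_eq_zero (h₁.trans hH) hvanish n hX hY _
  have : p ≫ g ≫ q = (p ≫ r.i) ≫ (r.r ≫ g ≫ r'.i) ≫ r'.r ≫ q := by simp
  change π.map _ = 0
  rw [this, π.map_comp (p ≫ r.i), π.map_comp (r.r ≫ g ≫ r'.i), hg, zero_comp, comp_zero]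

/-- For `M` in `C₁ ∩ C₂`, the weight truncations of `M` in `C₁` factor, in the Verdier quotient,
through all lower truncations. -/
lemma exists_factorization_through_truncation (hneg : IsNegativeSubcategory H)
    (hgen : IsCompactlyGeneratedBy H) (h₁ : H₁ ≤ H) (h₂ : H₂ ≤ H) (h₃ : H₃ ≤ H)
    (hvanish : ∀ (X Y : C) (f : X ⟶ Y), H₁ X → H₂ Y →
      (verdierFunctor (localizingClosure H₃)).map f = 0) {M A₀ B₀ : C}
    (hM₁ : localizingClosure H₁ M) (hM₂ : localizingClosure H₂ M) {m : ℤ} {α : A₀ ⟶ M}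
    {β : M ⟶ B₀} {γ : B₀ ⟶ A₀⟦(1 : ℤ)⟧} (hT : Triangle.mk α β γ ∈ distTriang C)
    (hB₀ : weightGE H (m + 1) B₀) (k : ℕ) {n : ℤ} (hn : m + k = n) {A : C}
    (hA : weightLE H n A) (hA₁ : localizingClosure H₁ A) (a : A ⟶ M) :
    ∃ ρ : (verdierFunctor (localizingClosure H₃)).obj A ⟶ _,
      ρ ≫ (verdierFunctor (localizingClosure H₃)).map α =
        (verdierFunctor (localizingClosure H₃)).map a := by
  let π := verdierFunctor (localizingClosure H₃)
  have hH := hgen.le_compact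
  induction k generalizing n A with
  | zero =>
    obtain rfl : m = n := by simpa using hn
    obtain ⟨c, rfl⟩ := exists_lift₁ hT a (hA B₀ hB₀ _)
    exact ⟨π.map c, (π.map_comp _ _).symm⟩
  | succ k ih =>
    obtain ⟨A', B', α', β', γ', hT', ⟨hA', -⟩, ⟨hB', hB'₂⟩⟩ :=
      exists_weight_decomposition h₂ hH hneg hM₂ (n - 1)
    obtain ⟨A'', B'', α'', β'', γ'', hT'', ⟨hA'', hA''₁⟩, ⟨hB'', -⟩⟩ :=
      exists_weight_decomposition h₁ hH hneg hM₁ (n - 1)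
    rw [sub_add_cancel] at hB'
    obtain ⟨ρ, hρ⟩ : ∃ ρ : π.obj A ⟶ π.obj A', ρ ≫ π.map α' = π.map a := exists_lift₁ (π.map_distinguished _ hT') (π.map a)
      (homVanishes_verdierFunctor_of_vanish hneg hgen h₁ h₂ h₃ hvanish hA hA₁ hB' hB'₂ _)
    -- Returning from C_2 to C_1 costs no weight and happens already in C.
    obtain ⟨c, rfl⟩ := exists_lift₁ hT'' α' (weightLE_le_of_le h₂ _ _ hA' _ hB'' _)
    obtain ⟨ρ', hρ'⟩ := ih (n := n - 1) (by push_cast at hn; omega)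
      (weightLE_le_of_le h₁ _ _ hA'') hA''₁ α''
    refine ⟨ρ ≫ π.map c ≫ ρ', ?_⟩
    rw [Category.assoc, Category.assoc, hρ', ← hρ, ← π.map_comp]

end

/-! ### Objects of the intersection in the quotient, and the theorem. -/

section

variable {C : Type u} [Category.{v} C] [Preadditive C] [HasZeroObject C] [HasShift C ℤ]
  [∀ n : ℤ, (shiftFunctor C n).Additive] [Pretriangulated C] [HasCoproducts.{v} C]
  [IsTriangulated C] {H H₁ H₂ H₃ : ObjectProperty C}

/-- In the Verdier quotient, the objects of `C₁ ∩ C₂` are left orthogonal to the positive part of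
the weight structure. -/
lemma homVanishes_verdierFunctor_of_mem_inter (hneg : IsNegativeSubcategory H)
    (hgen : IsCompactlyGeneratedBy H) (h₁ : H₁ ≤ H) (h₂ : H₂ ≤ H) (h₃ : H₃ ≤ H)
    (hvanish : ∀ (X Y : C) (f : X ⟶ Y), H₁ X → H₂ Y →
      (verdierFunctor (localizingClosure H₃)).map f = 0) {M Y : C}
    (hM₁ : localizingClosure H₁ M) (hM₂ : localizingClosure H₂ M) (hY : weightGE H 1 Y) :
    HomVanishes ((verdierFunctor (localizingClosure H₃)).obj M)
      ((verdierFunctor (localizingClosure H₃)).obj Y) := by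
  let π := verdierFunctor (localizingClosure H₃)
  have hH := hgen.le_compact
  -- Weight -1 is chosen so that A₀[1], which appears in the telescope, still has weight ≤ 0.
  obtain ⟨A₀, B₀, α₀, β₀, γ₀, hT₀, ⟨hA₀, -⟩, ⟨hB₀, -⟩⟩ :=
    exists_weight_decomposition h₁ hH hneg hM₁ (-1)
  replace hA₀ := weightLE_le_of_le h₁ _ _ hA₀
  choose A B α β γ hT hA hB using fun k : ℕ => exists_weight_decomposition h₁ hH hneg hM₁ k
  have hA' : ∀ k : ℕ, weightLE H k (A k) := fun k => weightLE_le_of_le h₁ _ _ (hA k).1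
  choose s hs using fun k => exists_lift₁ (hT (k + 1)) (α k)
    (weightLE_monotone (by push_cast; omega) _ (hA' k) _ (hB (k + 1)).1 _)
  choose ρ hρ using fun k => exists_factorization_through_truncation hneg hgen h₁ h₂ h₃ hvanish
    hM₁ hM₂ hT₀ hB₀ (k + 1) (n := k) (by push_cast; omega) (hA' k) (hA k).2 (α k)
  have hs' : ∀ k, ∃ c : A₀ ⟶ A (k + 1), ρ k ≫ π.map c = π.map (s k) := fun k => by
    obtain ⟨c, hc⟩ := exists_lift₁ (hT (k + 1)) α₀
      (weightLE_monotone (by push_cast; omega) _ hA₀ _ (hB (k + 1)).1 _)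
    refine ⟨c, ?_⟩
    -- The two maps agree after composing to π(M); their difference comes from B (k + 1)[-1], of
    -- weight ≥ k + 1, and so vanishes on A k.
    have hd : (ρ k ≫ π.map c - π.map (s k)) ≫ π.map (α (k + 1)) = 0 := by
      rw [Preadditive.sub_comp, Category.assoc, ← Functor.map_comp, ← Functor.map_comp, hc, hs,
        hρ, sub_self]
    obtain ⟨d, hd⟩ := exists_lift₁ (π.map_distinguished _ (inv_rot_of_distTriang _ (hT (k + 1))))
      _ hd
    have hd₀ : d = 0 := homVanishes_verdierFunctor_of_weight h₃ hH hneg (hA' k)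
      (weightGE_shift (hB (k + 1)).1 (by push_cast; omega)) d
    rw [← sub_eq_zero, ← hd, hd₀]
    exact zero_comp
  have hs'' : ∀ (k : ℕ) (z : π.obj ((A (k + 1))⟦(1 : ℤ)⟧) ⟶ π.obj Y),
      π.map ((s k)⟦(1 : ℤ)⟧') ≫ z = 0 := fun k z => by
    obtain ⟨c, hc⟩ := hs' k
    have hA₀' : HomVanishes ((π.obj A₀)⟦(1 : ℤ)⟧) (π.obj Y) :=
      (homVanishes_verdierFunctor_of_weight h₃ hH hneg (weightLE_shift hA₀ (by omega))
        (n := 0) hY).of_iso ((π.commShiftIso (1 : ℤ)).app A₀) (Iso.refl _)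
    rw [← cancel_epi ((π.commShiftIso (1 : ℤ)).inv.app (A k)), comp_zero,
      ← Functor.commShiftIso_inv_naturality_assoc, ← hc, Functor.map_comp, Category.assoc,
      hA₀' ((π.map c)⟦(1 : ℤ)⟧' ≫ _), comp_zero]
  let A' : ULift.{v} ℕ → C := fun k => A k.down
  let σ : ∐ A' ⟶ ∐ A' := Sigma.desc fun k => s k.down ≫ Sigma.ι A' ⟨k.down + 1⟩
  obtain ⟨p, δ, hp, hιp⟩ := exists_telescope_triangle (h₁.trans hH) hM₁ hT (fun k => (hA k).2)
    (fun k => weightGE_le_of_le h₁ _ _ (hB k).1) hs (σ := σ) (fun k => Sigma.ι_desc _ _)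
  intro g
  have hg : π.map p ≫ g = 0 :=
    verdierFunctor_eq_zero_of_coproduct (coproductIsCoproduct A') _ fun ⟨k⟩ => by
      change π.map (Sigma.ι A' ⟨k⟩) ≫ _ = 0
      rw [← Functor.map_comp_assoc, hιp, ← hρ, Category.assoc,
        homVanishes_verdierFunctor_of_weight h₃ hH hneg
          (weightLE_monotone (n := 0) (by omega) _ hA₀) hY (π.map α₀ ≫ g), comp_zero]
  obtain ⟨h, hh⟩ : ∃ h : π.obj ((∐ A')⟦(1 : ℤ)⟧) ⟶ π.obj Y, π.map δ ≫ h = g := by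
    obtain ⟨h, hh⟩ := exists_desc₂ (rot_of_distTriang _ (π.map_distinguished _ hp)) g hg
    exact ⟨(π.commShiftIso (1 : ℤ)).hom.app _ ≫ h, (Category.assoc _ _ _).symm.trans hh⟩
  have hσ : π.map (σ⟦(1 : ℤ)⟧') ≫ h = 0 :=
    verdierFunctor_eq_zero_of_coproduct (isColimitCofanMkObjOfIsColimit (shiftFunctor C (1 : ℤ)) _ _
      (coproductIsCoproduct A')) _ fun ⟨k⟩ => by
        change π.map ((Sigma.ι A' ⟨k⟩)⟦(1 : ℤ)⟧') ≫ _ = 0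
        have : Sigma.ι A' ⟨k⟩ ≫ σ = s k ≫ Sigma.ι A' ⟨k + 1⟩ := Sigma.ι_desc _ _
        rw [← Functor.map_comp_assoc, ← Functor.map_comp, this, Functor.map_comp, Functor.map_comp,
          Category.assoc, hs'']
  -- Thus δ = δ ≫ σ[1], and σ[1] is already killed by `h` in the quotient.
  have hδ : δ ≫ (𝟙 (∐ A') - σ)⟦(1 : ℤ)⟧' = 0 := comp_distTriang_mor_zero₃₁ _ hp
  rw [Functor.map_sub, CategoryTheory.Functor.map_id, Preadditive.comp_sub, Category.comp_id,
    sub_eq_zero] at hδ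
  rw [← hh, hδ, Functor.map_comp, Category.assoc, hσ, comp_zero]

end

theorem mainTheorem6 {C : Type u} [Category.{v} C] [Preadditive C] [HasZeroObject C]
    [HasShift C ℤ] [∀ n : ℤ, (shiftFunctor C n).Additive] [Pretriangulated C]
    [IsTriangulated C] [HasCoproducts.{v} C]
    (H H₁ H₂ H₃ : ObjectProperty C)
    (hH : IsAdditiveSubcategory H) (hneg : IsNegativeSubcategory H)
    (hgen : IsCompactlyGeneratedBy H)
    (h₁ : H₁ ≤ H) (h₂ : H₂ ≤ H) (h₃ : H₃ ≤ H)
    (hadd₁ : IsAdditiveSubcategory H₁) (hadd₂ : IsAdditiveSubcategory H₂)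
    (hadd₃ : IsAdditiveSubcategory H₃)
    (hvanish : ∀ (X Y : C) (f : X ⟶ Y), H₁ X → H₂ Y →
      (verdierFunctor (localizingClosure H₃)).map f = 0) :
    (∃! w : WeightStructure C, w.IsGeneratedBy H) ∧
    ∀ w : WeightStructure C, w.IsGeneratedBy H →
      ∃ w' : WeightStructure (VerdierQuotient (localizingClosure H₃)),
        IsInducedOnQuotient w (localizingClosure H₃) w' ∧
        ∀ M : C, localizingClosure H₁ M → localizingClosure H₂ M →
          w'.IsRightDegenerate ((verdierFunctor (localizingClosure H₃)).obj M) ∧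
          (w.IsBoundedBelow M → localizingClosure H₃ M) := by
  refine ⟨existsUnique_isGeneratedBy hneg hgen, fun w hw => ?_⟩
  obtain ⟨w', hw'⟩ := exists_isInducedOnQuotient hw h₃ hgen.le_compact hneg
  refine ⟨w', hw', fun M hM₁ hM₂ => ?_⟩
  let π := verdierFunctor (localizingClosure H₃)
  have key : ∀ (a : ℤ) (Y : C), weightGE H 1 Y → HomVanishes (π.obj (M⟦a⟧)) (π.obj Y) :=
    fun a Y hY => homVanishes_verdierFunctor_of_mem_inter hneg hgen h₁ h₂ h₃ hvanish
      ((localizingClosure H₁).le_shift a _ hM₁) ((localizingClosure H₂).le_shift a _ hM₂) hY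
  refine ⟨fun i => ?_, fun ⟨i, hi⟩ => ?_⟩
  · have := w'.le_retracts
    rw [shiftedClass_iff, w'.le_eq_leftOrthogonal, hw'.ge_eq, shiftedClass_retractClosure_map,
      hw.ge_eq, shiftedClass_weightGE H (zero_add 1)]
    rintro Z f ⟨N, hN, ⟨r⟩⟩
    obtain ⟨Y, hY, ⟨e⟩⟩ := (ObjectProperty.prop_map_iff _ _ _).1 hN
    exact (((key (-i) Y hY).of_iso ((π.commShiftIso (-i)).app M) e).of_retract_right r) f
  · rw [hw.ge_eq, shiftedClass_weightGE H (zero_add i)] at hi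
    -- The shift by 1 - i raises the weight from ≥ i to ≥ 1, so this object can serve as source and
    -- target at once.
    have h := key (1 - i) (M⟦1 - i⟧) (weightGE_shift hi (by omega))
    exact (ObjectProperty.prop_shift_iff_of_isStableUnderShift _ M (1 - i)).1
      (localizingClosure_of_isZero ((IsZero.iff_id_eq_zero _).2 (h (𝟙 _))))
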